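/- Let $G$ be a connected simple graph with $N$ vertices and $K\ge 2$ edges, and let $\mathbb F_q$ be a finite field. Vertices are servers; each edge $k$ carries a message $W_k$ of $L$ symbols, all symbols being i.i.d. uniform on $\mathbb F_q$, and server $i$ stores the set $\mathcal W_i$ of messages of the edges incident to it. With fully-replicated randomness all servers also share a random variable $\mathcal R$ on a finite set. The user has private randomness $\mathcal Q$ (finite-valued), and $\mathcal Q,\mathcal W,\mathcal R$ are independent. To retrieve $W_k$ the user sends to each server $i$ a query $Q_i^{[k]}$, a function of $\mathcal Q$ (and $k$); server $i$ returns an answer $A_i^{[k]}$, a tuple of symbols of $\mathbb F_q$ whose length depends only on $i$, that is a function of $(Q_i^{[k]},\mathcal W_i,\mathcal R)$. Entropies are in $q$-ary units. An *SPIR scheme with fully-replicated randomness* is such a scheme with $L\ge 1$ that satisfies, for all $i,k,k'$: - (user privacy) $(Q_i^{[k]},A_i^{[k]},\mathcal W_i,\mathcal R)\sim(Q_i^{[k']},A_i^{[k']},\mathcal W_i,\mathcal R)$; - (reliability) $H(W_k\mid A_1^{[k]},\dots,A_N^{[k]},\mathcal Q)=0$; - (database privacy) $I(\mathcal W\setminus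 W_k;A_1^{[k]},\dots,A_N^{[k]}\mid\mathcal Q)=0$. Its rate is $L/\sum_i H(A_i^{[k]})$ and its total randomness ratio is $H(\mathcal R)/L$. The capacity $\mathscr C_{FR}(G)$ is the supremum of the rates, and $\rho^*_{total}(G)$ the infimum of the total randomness ratios, of all such schemes. A *PIR scheme* has no common randomness and has to satisfy only user privacy and reliability; it is *linear* if, for every query, each server's answer is an $\mathbb F_q$-linear function of its stored messages (in particular if all downloaded symbols are sums of message symbols). It has the *symmetric retrieval property* if $H(A_i^{[k]}\mid Q_i^{[k]},\mathcal W_i\setminus\{W_k\})=H(W_k)/2$ for every $k$ and both servers $i$ storing $W_k$. **Theorem.** Suppose that a linear PIR scheme on $G$ over $\mathbb F_q$ has the symmetric retrieval property, uses an even number $L'$ of symbols per message, and downloads $D'$ symbols in total. Put $\ell=\operatorname{lcm}(L'/2,N-1)$, $x=\ell/(L'/2)$ and $y=\ell/(N-1)$. Then there is an SPIR scheme on $G$ over $\mathbb F_q$ with fully-replicated randomness whose rate, for every desired message, is $$\frac{L'x}{D'x+Ny},$$ and whose total randomness ratio is $$\frac{K-1}{2}+\frac{Ny}{L'x}.$$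 Consequently $\frac{L'x}{D'x+Ny}\le\mathscr C_{FR}(G)$ and $\rho^*_{total}(G)\le\frac{K-1}{2}+\frac{Ny}{L'x}$. -/

import Mathlib

noncomputable section

namespace GraphPIR

/-! ### Shannon information of finitely supported random variables -/

section Entropy

variable {S α β γ : Type*}

/-- Shannon entropy, in `q`-ary units, of a finitely supported law `p`. -/
def lawEntropy (q : ℕ) (p : PMF α) : ℝ :=
  ∑ᶠ a, Real.negMulLog (p a).toReal / Real.log q

/-- `H(X)` for a random variable `X` on the probability space `(S, P)`. -/
def entropy (q : ℕ) (P : PMF S) (X : S → α) : ℝ :=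
  lawEntropy q (P.map X)

/-- `H(X | Y) = H(X, Y) - H(Y)`. -/
def condEntropy (q : ℕ) (P : PMF S) (X : S → α) (Y : S → β) : ℝ :=
  entropy q P (fun s => (X s, Y s)) - entropy q P Y

/-- `I(X ; Y | Z) = H(X | Z) - H(X | Y, Z)`. -/
def condMutualInfo (q : ℕ) (P : PMF S) (X : S → α) (Y : S → β) (Z : S → γ) : ℝ :=
  condEntropy q P X Z - condEntropy q P X (fun s => (Y s, Z s))

end Entropy

/-! ### Retrieval schemes on a graph-replicated database

Servers are the vertices of `G`, messages are the edges of `G`, and a server stores the messages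
of the edges incident to it. -/

/-- A database: one message of `L` symbols of `F` for each edge of `G`. -/
abbrev Messages {V : Type} (F : Type) (G : SimpleGraph V) (L : ℕ) : Type :=
  G.edgeSet → Fin L → F

/-- The (indices of the) messages stored at server `i`. -/
abbrev Stored {V : Type} (G : SimpleGraph V) (i : V) : Type :=
  {e : G.edgeSet // i ∈ (e : Sym2 V)}

/-- A one-round retrieval scheme on `G` whose servers all share a common randomness with values
in `R`. The queries are functions of the desired index and of the user's private randomness;
the answer of server `i`, made of `len i` downloaded symbols of `F`, is a function of its query, its
stored messages and the common randomness. -/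
structure Scheme {V : Type} (F : Type) (G : SimpleGraph V) (R : Type) where
  /-- number of symbols per message -/
  L : ℕ
  L_pos : 0 < L
  /-- alphabet and law of the user's private randomness -/
  UserRand : Type
  finite_userRand : Finite UserRand
  userLaw : PMF UserRand
  /-- law of the common randomness of the servers -/
  randLaw : PMF R
  Query : V → Type
  query : G.edgeSet → UserRand → (i : V) → Query i
  /-- number of symbols downloaded from each server -/
  len : V → ℕ
  answer : (i : V) → Query i → (Stored G i → Fin L → F) → R → (Fin (len i) → F)

/-- In a PIR scheme the servers have no common randomness. -/
abbrev PIRScheme {V : Type} (F : Type) (G : SimpleGraph V) : Type 1 := Scheme F G Unit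

namespace Scheme

variable {V F R : Type} [Fintype V] [Field F] [Fintype F] {G : SimpleGraph V}

/-- The sample space: user's randomness, database, common randomness. -/
abbrev Sample (S : Scheme F G R) : Type := S.UserRand × Messages F G S.L × R

/-- The three components are independent and the message symbols are i.i.d. uniform. -/
def law (S : Scheme F G R) : PMF S.Sample :=
  letI : Fintype (Messages F G S.L) := Fintype.ofFinite _
  S.userLaw.bind fun u =>
    (PMF.uniformOfFintype (Messages F G S.L)).bind fun w =>
      S.randLaw.map fun r => (u, w, r)

/-- The user's randomness. -/
def U (S : Scheme F G R) (s : S.Sample) : S.UserRand := s.1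

/-- The message of edge `k`. -/
def W (S : Scheme F G R) (k : G.edgeSet) (s : S.Sample) : Fin S.L → F := s.2.1 k

/-- All messages except that of edge `k`. -/
def WOther (S : Scheme F G R) (k : G.edgeSet) (s : S.Sample) :
    {e : G.edgeSet // e ≠ k} → Fin S.L → F :=
  fun e => s.2.1 e.1

/-- The messages stored at server `i`. -/
def WStored (S : Scheme F G R) (i : V) (s : S.Sample) : Stored G i → Fin S.L → F :=
  fun e => s.2.1 e.1

/-- The messages stored at server `i`, except that of edge `k`. -/
def WStoredOther (S : Scheme F G R) (i : V) (k : G.edgeSet) (s : S.Sample) :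
    {e : Stored G i // e.1 ≠ k} → Fin S.L → F :=
  fun e => s.2.1 e.1.1

/-- The common randomness. -/
def Rand (S : Scheme F G R) (s : S.Sample) : R := s.2.2

/-- The query to server `i` when message `k` is desired. -/
def Q (S : Scheme F G R) (k : G.edgeSet) (i : V) (s : S.Sample) : S.Query i :=
  S.query k s.1 i

/-- The answer of server `i` when message `k` is desired. -/
def A (S : Scheme F G R) (k : G.edgeSet) (i : V) (s : S.Sample) : Fin (S.len i) → F :=
  S.answer i (S.Q k i s) (S.WStored i s) (S.Rand s)

/-- The answers of all servers when message `k` is desired. -/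
def AAll (S : Scheme F G R) (k : G.edgeSet) (s : S.Sample) : (i : V) → Fin (S.len i) → F :=
  fun i => S.A k i s

/-- What server `i` sees has the same law for any two desired indices. -/
def UserPrivacy (S : Scheme F G R) : Prop :=
  ∀ (i : V) (k k' : G.edgeSet),
    S.law.map (fun s => (S.Q k i s, S.A k i s, S.WStored i s, S.Rand s)) =
      S.law.map (fun s => (S.Q k' i s, S.A k' i s, S.WStored i s, S.Rand s))

/-- `H(W_k | A_1, …, A_N, 𝒬) = 0` for every `k`. -/
def Reliable (S : Scheme F G R) : Prop :=
  ∀ k : G.edgeSet,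
    condEntropy (Fintype.card F) S.law (S.W k) (fun s => (S.AAll k s, S.U s)) = 0

/-- `I(W_{k̄} ; A_1, …, A_N | 𝒬) = 0` for every `k`. -/
def DatabasePrivacy (S : Scheme F G R) : Prop :=
  ∀ k : G.edgeSet,
    condMutualInfo (Fintype.card F) S.law (S.WOther k) (S.AAll k) S.U = 0

/-- The requirements on a PIR scheme. -/
def IsPIR (S : Scheme F G Unit) : Prop := S.UserPrivacy ∧ S.Reliable

/-- The requirements on an SPIR scheme with fully-replicated common randomness. -/
def IsSPIR (S : Scheme F G R) : Prop := S.UserPrivacy ∧ S.Reliable ∧ S.DatabasePrivacy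

/-- For every query, the answer of each server is an `F`-linear function of the messages stored
there. -/
def IsLinear (S : Scheme F G Unit) : Prop :=
  ∀ (i : V) (q : S.Query i), IsLinearMap F (fun w => S.answer i q w ())

/-- Symmetric retrieval property: `H(A_i | Q_i, W_i ∖ W_k) = H(W_k) / 2` for each of the two servers
`i` that store the desired message `k`. -/
def SymmetricRetrieval (S : Scheme F G Unit) : Prop :=
  ∀ (k : G.edgeSet) (i : V), i ∈ (k : Sym2 V) →
    condEntropy (Fintype.card F) S.law (S.A k i) (fun s => (S.Q k i s, S.WStoredOther i k s)) =
      entropy (Fintype.card F) S.law (S.W k) / 2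

/-- Total number of downloaded symbols. -/
def downloads (S : Scheme F G R) : ℕ := ∑ i, S.len i

/-- `L / ∑ i, H(A_i)` when message `k` is desired. -/
def rate (S : Scheme F G R) (k : G.edgeSet) : ℝ :=
  S.L / ∑ i, entropy (Fintype.card F) S.law (S.A k i)

/-- Total randomness ratio `H(R) / L`. -/
def totalRandRatio (S : Scheme F G R) : ℝ :=
  entropy (Fintype.card F) S.law S.Rand / S.L

end Scheme

section Metrics

variable {V : Type} (F : Type) [Fintype V] [Field F] [Fintype F] (G : SimpleGraph V)

/-- SPIR capacity of `G` over `F` with fully-replicated randomness: the supremum, in the extended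
reals, of all achievable rates. -/
def capacityFR : EReal :=
  sSup {r : EReal | ∃ (R : Type) (_ : Finite R) (S : Scheme F G R), S.IsSPIR ∧
    ∀ k, r = (S.rate k : EReal)}

/-- Optimum total randomness ratio: the infimum, in the extended reals, over all feasible SPIR
schemes with fully-replicated randomness. -/
def optTotalRandRatio : EReal :=
  sInf {r : EReal | ∃ (R : Type) (_ : Finite R) (S : Scheme F G R), S.IsSPIR ∧
    r = (S.totalRandRatio : EReal)}

end Metrics

end GraphPIR

end

/-! Run `M` copies of the PIR scheme on messages of length `L = M * L'`. By linearity and symmetric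
retrieval, each server sees a stored message through a surjection onto `n = L / 2` coordinates.
Since two surjections have a common section (`exists_common_section`), the queries can be changed so
that both servers storing an undesired message see it through the same `n` coordinates, up to
automorphisms (`exists_alignedCode`). One shared mask of length `n` per message then hides every
undesired message, and privacy of the index comes from random changes of coordinates. The desired
message is masked as well, so the user must learn its mask. All servers hold all masks, so this is
symmetric PIR from `N` fully replicated servers: with `n = (N - 1) * z`, each server returns `z`
more symbols, protected by one further shared vector of length `z`. The download is `M * D' + N *
z`, the common randomness `K * n + z`. Symmetric retrieval only fixes the mean rank over queries,
whose probabilities may be irrational. The copies therefore use a finite list of values of the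
user's randomness that satisfies every integral linear relation between the probabilities
(`exists_balanced_sample`). On it mean ranks become exact totals, and equality of query laws becomes
equality of query multisets (`exists_alignedCode_of_isPIR`). -/

namespace GraphPIR

/-! ### Entropy on finite sample spaces. -/

section Entropy

open scoped Classical

variable {S α β : Type*}

lemma map_toReal_pos (P : PMF S) (X : S → α) {s : S} (hs : P s ≠ 0) :
    0 < (P.map X (X s)).toReal := by
  refine ENNReal.toReal_pos ?_ (PMF.apply_ne_top _ _)
  rw [← PMF.mem_support_iff, PMF.support_map]
  exact ⟨s, hs, rfl⟩

variable [Fintype S]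

/-- The probability of an event `X = a` as a finite sum. -/
lemma map_toReal_eq_sum (P : PMF S) (X : S → α) (a : α) :
    (P.map X a).toReal = ∑ s, if X s = a then (P s).toReal else 0 := by
  rw [PMF.map_apply, tsum_fintype, ENNReal.toReal_sum]
  · refine Finset.sum_congr rfl fun s _ => ?_
    by_cases h : X s = a
    · simp [h]
    · simp [h, Ne.symm h]
  · intro s _
    split_ifs
    · exact P.apply_ne_top s
    · simp

/-- Entropy as the expectation of the surprise. -/
lemma entropy_eq_sum (q : ℕ) (P : PMF S) (X : S → α) :
    entropy q P X =
      ∑ s, (P s).toReal * (-Real.log (P.map X (X s)).toReal / Real.log q) := by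
  have h0 : Function.support (fun a => Real.negMulLog (P.map X a).toReal / Real.log q) ⊆
      (Finset.univ.image X : Finset α) := by
    intro a ha
    by_contra hne
    apply ha
    have : (P.map X a).toReal = 0 := by
      rw [map_toReal_eq_sum]
      refine Finset.sum_eq_zero fun s _ => if_neg fun h => hne ?_
      simp only [Finset.coe_image, Finset.coe_univ, Set.image_univ, Set.mem_range]
      exact ⟨s, h⟩
    simp only [this, Real.negMulLog_zero, zero_div]
  rw [entropy, lawEntropy, finsum_eq_sum_of_support_subset _ h0,
    ← Finset.sum_fiberwise_of_maps_to (s := Finset.univ) (t := Finset.univ.image X) (g := X)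
      (fun s _ => Finset.mem_image_of_mem X (Finset.mem_univ s))]
  refine Finset.sum_congr rfl fun a _ => ?_
  have h1 : ∑ s with X s = a, (P s).toReal * (-Real.log (P.map X (X s)).toReal / Real.log q) =
      ∑ s with X s = a, (P s).toReal * (-Real.log (P.map X a).toReal / Real.log q) :=
    Finset.sum_congr rfl fun s hs => by rw [(Finset.mem_filter.1 hs).2]
  rw [h1, ← Finset.sum_mul, Finset.sum_filter, ← map_toReal_eq_sum, Real.negMulLog]
  ring

lemma condEntropy_eq_sum (q : ℕ) (P : PMF S) (X : S → α) (Y : S → β) :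
    condEntropy q P X Y = ∑ s, (P s).toReal *
      (Real.log ((P.map Y (Y s)).toReal / (P.map (fun t => (X t, Y t)) (X s, Y s)).toReal) /
        Real.log q) := by
  rw [condEntropy, entropy_eq_sum, entropy_eq_sum, ← Finset.sum_sub_distrib]
  refine Finset.sum_congr rfl fun s _ => ?_
  by_cases hs : P s = 0
  · simp [hs]
  · have h1 := map_toReal_pos P Y hs
    have h2 := map_toReal_pos P (fun t => (X t, Y t)) hs
    rw [Real.log_div h1.ne' h2.ne']
    ring

lemma map_pair_toReal_le (P : PMF S) (X : S → α) (Y : S → β) (a : α) (b : β) :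
    (P.map (fun t => (X t, Y t)) (a, b)).toReal ≤ (P.map Y b).toReal := by
  rw [map_toReal_eq_sum, map_toReal_eq_sum]
  refine Finset.sum_le_sum fun s _ => ?_
  by_cases h : Y s = b
  · simp only [Prod.mk.injEq, h, and_true, if_true]
    split_ifs <;> simp
  · simp [h]

/-- If `H(X | Y) = 0` then `X` is a function of `Y` on the support. -/
lemma eq_of_condEntropy_eq_zero {q : ℕ} (hq : 1 < q) {P : PMF S} {X : S → α} {Y : S → β}
    (h : condEntropy q P X Y = 0) {s t : S} (hs : P s ≠ 0) (ht : P t ≠ 0) (hst : Y s = Y t) :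
    X s = X t := by
  have hlog : 0 < Real.log q := Real.log_pos (by exact_mod_cast hq)
  -- A joint probability never exceeds the marginal, so all summands are nonnegative and hence zero:
  -- on the support, joint and marginal agree. An outcome with the same `Y` and another `X` would
  -- make the marginal strictly larger.
  rw [condEntropy_eq_sum, Finset.sum_eq_zero_iff_of_nonneg] at h
  · have h1 := h s (Finset.mem_univ s)
    have hps : (P s).toReal ≠ 0 := (ENNReal.toReal_pos hs (P.apply_ne_top s)).ne'
    have hpt : 0 < (P t).toReal := ENNReal.toReal_pos ht (P.apply_ne_top t)
    have hY := map_toReal_pos P Y hs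
    have hXY := map_toReal_pos P (fun t => (X t, Y t)) hs
    have hle := map_pair_toReal_le P X Y (X s) (Y s)
    have h2 : Real.log ((P.map Y (Y s)).toReal /
        (P.map (fun t => (X t, Y t)) (X s, Y s)).toReal) = 0 := by
      rcases mul_eq_zero.1 h1 with h | h
      · exact absurd h hps
      · rcases div_eq_zero_iff.1 h with h | h
        · exact h
        · exact absurd h hlog.ne'
    have h3 := Real.eq_one_of_pos_of_log_eq_zero (div_pos hY hXY) h2
    rw [div_eq_one_iff_eq hXY.ne', map_toReal_eq_sum, map_toReal_eq_sum] at h3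
    by_contra hne
    refine h3.not_gt (Finset.sum_lt_sum (fun r _ => ?_) ⟨t, Finset.mem_univ t, ?_⟩)
    · by_cases h : Y r = Y s
      · simp only [Prod.mk.injEq, h, and_true, if_true]
        split_ifs <;> simp
      · simp [h]
    · simp only [Prod.mk.injEq, hst, and_true, if_true, if_neg (Ne.symm hne)]
      exact hpt
  · intro s _
    by_cases hs : P s = 0
    · simp [hs]
    · have hXY := map_toReal_pos P (fun t => (X t, Y t)) hs
      have hle := map_pair_toReal_le P X Y (X s) (Y s)
      exact mul_nonneg ENNReal.toReal_nonneg
        (div_nonneg (Real.log_nonneg ((one_le_div hXY).2 hle)) hlog.le)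

/-- If `X` is a function of `Y` then `H(X | Y) = 0`. -/
lemma condEntropy_eq_zero_of_function (q : ℕ) (P : PMF S) {X : S → α} {Y : S → β}
    (h : ∀ s t, Y s = Y t → X s = X t) : condEntropy q P X Y = 0 := by
  rw [condEntropy_eq_sum]
  refine Finset.sum_eq_zero fun s _ => ?_
  have : (P.map (fun t => (X t, Y t)) (X s, Y s)).toReal = (P.map Y (Y s)).toReal := by
    rw [map_toReal_eq_sum, map_toReal_eq_sum]
    refine Finset.sum_congr rfl fun t _ => ?_
    by_cases hY : Y t = Y s
    · simp [hY, h t s hY]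
    · simp [hY]
  rw [this]
  rcases eq_or_ne (P.map Y (Y s)).toReal 0 with h0 | h0
  · rw [h0, div_zero, Real.log_zero, zero_div, mul_zero]
  · rw [div_self h0, Real.log_one, zero_div, mul_zero]

variable [Nonempty S]

lemma uniform_toReal (s : S) :
    (PMF.uniformOfFintype S s).toReal = (Fintype.card S : ℝ)⁻¹ := by
  simp

lemma sum_uniform_toReal_mul (c : ℝ) :
    ∑ s, (PMF.uniformOfFintype S s).toReal * c = c := by
  simp

/-- A uniform law is invariant under an injective self-map. -/
lemma map_uniform_comp (X : S → α) {π : S → S} (hπ : Function.Injective π) :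
    (PMF.uniformOfFintype S).map (fun s => X (π s)) = (PMF.uniformOfFintype S).map X := by
  ext a
  rw [← ENNReal.toReal_eq_toReal_iff' (PMF.apply_ne_top _ _) (PMF.apply_ne_top _ _),
    map_toReal_eq_sum, map_toReal_eq_sum]
  simp only [uniform_toReal]
  exact (Equiv.ofBijective π (Finite.injective_iff_bijective.1 hπ)).sum_comp
    (fun s => if X s = a then (Fintype.card S : ℝ)⁻¹ else 0)

/-- If translations of `X` are realised by symmetries of the uniform sample space that preserve
`Y`, then `X` is uniform given `Y`. -/
lemma condEntropy_uniform [AddGroup α] [Fintype α] (q : ℕ) (X : S → α) (Y : S → β)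
    (h : ∀ δ : α, ∃ π : S → S, Function.Injective π ∧
      ∀ s, X (π s) = X s + δ ∧ Y (π s) = Y s) :
    condEntropy q (PMF.uniformOfFintype S) X Y = Real.log (Fintype.card α) / Real.log q := by
  set P := PMF.uniformOfFintype S
  have hP (s : S) : P s ≠ 0 := by simp [P]
  have key (a a' : α) (b : β) : (P.map (fun t => (X t, Y t)) (a, b)).toReal =
      (P.map (fun t => (X t, Y t)) (a', b)).toReal := by
    -- This symmetry carries `X = a` to `X = a'` inside each fibre of `Y`, so the joint law is
    -- constant along the fibre.
    obtain ⟨π, hπ, hs⟩ := h (-a + a')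
    conv_rhs => rw [← map_uniform_comp (fun t => (X t, Y t)) hπ]
    rw [map_toReal_eq_sum, map_toReal_eq_sum]
    refine Finset.sum_congr rfl fun s _ => ?_
    have : X s + (-a + a') = a' ↔ X s = a := by
      rw [← add_assoc, add_eq_right, ← sub_eq_add_neg, sub_eq_zero]
    simp only [(hs s).1, (hs s).2, Prod.mk.injEq, this, P]
  have hsum (b : β) : ∑ a, (P.map (fun t => (X t, Y t)) (a, b)).toReal = (P.map Y b).toReal := by
    simp_rw [map_toReal_eq_sum]
    rw [Finset.sum_comm]
    refine Finset.sum_congr rfl fun s _ => ?_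
    by_cases hY : Y s = b <;> simp [hY]
  rw [condEntropy_eq_sum]
  rw [← sum_uniform_toReal_mul (S := S) (Real.log (Fintype.card α) / Real.log q)]
  refine Finset.sum_congr rfl fun s _ => ?_
  have hpos := map_toReal_pos P (fun t => (X t, Y t)) (hP s)
  have : (P.map Y (Y s)).toReal =
      Fintype.card α * (P.map (fun t => (X t, Y t)) (X s, Y s)).toReal := by
    rw [← hsum, Finset.sum_congr rfl fun a _ => key a (X s) (Y s)]
    simp
  rw [this, mul_div_cancel_right₀ _ hpos.ne']

lemma entropy_uniform [AddGroup α] [Fintype α] (q : ℕ) (X : S → α)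
    (h : ∀ δ : α, ∃ π : S → S, Function.Injective π ∧ ∀ s, X (π s) = X s + δ) :
    entropy q (PMF.uniformOfFintype S) X = Real.log (Fintype.card α) / Real.log q := by
  have h1 := condEntropy_uniform q X (fun _ => ()) fun δ => by
    obtain ⟨π, h1, h2⟩ := h δ
    exact ⟨π, h1, fun s => ⟨h2 s, rfl⟩⟩
  rw [← h1, entropy_eq_sum, condEntropy_eq_sum]
  refine Finset.sum_congr rfl fun s _ => ?_
  have h2 : ((PMF.uniformOfFintype S).map (fun _ : S => ()) ()).toReal = 1 := by
    rw [map_toReal_eq_sum]; simp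
  have h3 : ((PMF.uniformOfFintype S).map (fun t => (X t, ())) (X s, ())).toReal =
      ((PMF.uniformOfFintype S).map X (X s)).toReal := by
    rw [map_toReal_eq_sum, map_toReal_eq_sum]; simp
  rw [h2, h3, one_div, Real.log_inv]

end Entropy

/-! ### The masked scheme of an aligned code. -/

section Construction

variable {V F : Type} {G : SimpleGraph V} [Field F]

/-- Linear retrieval data in which every undesired message is seen through one and the same
projection by both servers that store it. Server `i` combines the projections of its stored
messages by the maps `comb i`; when `k` is desired, the projection of message `e` used at server
`i` is twisted by `msgTwist k i e`, which for `e ≠ k` descends to `projTwist k i e`. -/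
structure AlignedCode (F : Type) [Field F] (G : SimpleGraph V) [Fintype G.edgeSet]
    (L n : ℕ) (d : V → ℕ) where
  comb : (i : V) → G.edgeSet → (Fin n → F) →ₗ[F] (Fin (d i) → F)
  comb_eq_zero : ∀ i (e : G.edgeSet), i ∉ (e : Sym2 V) → comb i e = 0
  proj : (Fin L → F) →ₗ[F] (Fin n → F)
  msgTwist : G.edgeSet → V → G.edgeSet → ((Fin L → F) ≃ₗ[F] (Fin L → F))
  projTwist : G.edgeSet → V → G.edgeSet → ((Fin n → F) ≃ₗ[F] (Fin n → F))
  proj_msgTwist : ∀ k i e, e ≠ k → ∀ w, proj (msgTwist k i e w) = projTwist k i e (proj w)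
  -- Decodability as a kernel condition; `z e` stands for any vector in the place of an undesired
  -- message, in particular a masked projection.
  decodable : ∀ k w (z : G.edgeSet → Fin n → F),
    open scoped Classical in
    (∀ i, ∑ e, comb i e (if e = k then proj (msgTwist k i e w) else projTwist k i e (z e)) = 0) →
      w = 0

-- Justifies the value `0` that `scheme` substitutes for messages the server does not store.
open scoped Classical in
lemma AlignedCode.comb_stored [Fintype G.edgeSet] {L n : ℕ} {d : V → ℕ}
    (D : AlignedCode F G L n d) (i : V) (e : G.edgeSet)
    {u : (Fin L → F) → (Fin L → F)} (w : Fin L → F) (z : Fin n → F) :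
    D.comb i e (D.proj (u (if i ∈ (e : Sym2 V) then w else 0)) + z) =
      D.comb i e (D.proj (u w) + z) := by
  by_cases h : i ∈ (e : Sym2 V)
  · rw [if_pos h]
  · rw [D.comb_eq_zero i e h, LinearMap.zero_apply, LinearMap.zero_apply]

/-- A splitting of a vector of length `n` into one part of length `y` for each server other than a
distinguished one. -/
structure Splitting (V F : Type) [Field F] (n y : ℕ) where
  root : V
  part : V → (Fin n → F) →ₗ[F] (Fin y → F)
  -- The root's answer carries interference only; subtracting it from the other answers isolates the
  -- parts of the desired mask.
  part_root : part root = 0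
  ext_part : ∀ s, (∀ v, part v s = 0) → s = 0

namespace AlignedCode

variable [Fintype V] [Fintype G.edgeSet] {L n y : ℕ} {d : V → ℕ}

/-- The private randomness of the user: a random change of coordinates for every message and every
mask, the coefficients used for retrieving a mask, and a pad for each answer. -/
abbrev UserRand (_ : AlignedCode F G L n d) (y : ℕ) : Type :=
  (G.edgeSet → ((Fin L → F) ≃ₗ[F] (Fin L → F))) × (G.edgeSet → ((Fin n → F) ≃ₗ[F] (Fin n → F))) ×
    (G.edgeSet → V → F) × ((i : V) → Fin (d i + y) → F)

/-- The common randomness: a mask for every message, and a mask for the retrieval of the masks. -/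
abbrev CommonRand (_ : AlignedCode F G L n d) (y : ℕ) : Type :=
  (G.edgeSet → Fin n → F) × (Fin y → F)

instance {m : ℕ} [Fintype F] : Finite ((Fin m → F) ≃ₗ[F] (Fin m → F)) := DFunLike.finite _

open scoped Classical

/-- The retrieval scheme built from an aligned code: the projections of the messages are masked by
common randomness, and the mask of the desired message is retrieved by a symmetrically private
scheme from the servers, all of which hold all masks. -/
noncomputable def scheme [Fintype F] (D : AlignedCode F G L n d) (B : Splitting V F n y)
    (hL : 0 < L) : Scheme F G (D.CommonRand y) where
  L := L
  L_pos := hL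
  UserRand := D.UserRand y
  finite_userRand := inferInstance
  userLaw :=
    letI : Fintype (D.UserRand y) := Fintype.ofFinite _
    PMF.uniformOfFintype (D.UserRand y)
  randLaw := PMF.uniformOfFintype (D.CommonRand y)
  Query := fun i => (G.edgeSet → ((Fin L → F) ≃ₗ[F] (Fin L → F))) ×
    (G.edgeSet → ((Fin n → F) ≃ₗ[F] (Fin n → F))) × (G.edgeSet → V → F) × (Fin (d i + y) → F)
  -- A uniform automorphism followed by a fixed twist is still uniform, as is a shifted uniform
  -- coefficient, so no single query depends in law on `k`.
  query := fun k u i => (fun e => u.1 e ≪≫ₗ D.msgTwist k i e,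
    fun e => u.2.1 e ≪≫ₗ D.projTwist k i e,
    fun e v => u.2.2.1 e v + if e = k ∧ v = i then 1 else 0, u.2.2.2 i)
  len := fun i => d i + y
  -- The pad is known to the user and hides nothing; it makes the answer uniform, so that its
  -- entropy equals its length.
  answer := fun i q w r => q.2.2.2 + Fin.append
    (∑ e : G.edgeSet, D.comb i e (D.proj (q.1 e
      (if h : i ∈ (e : Sym2 V) then w ⟨e, h⟩ else 0)) + q.2.1 e (r.1 e)))
    (r.2 + ∑ e, ∑ v, q.2.2.1 e v • B.part v (r.1 e))

/-- The sample space of the scheme built from an aligned code. -/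
abbrev View (D : AlignedCode F G L n d) (y : ℕ) : Type :=
  D.UserRand y × (G.edgeSet → Fin L → F) × D.CommonRand y

/-- The answer of server `i` when message `k` is desired. -/
noncomputable def ans (D : AlignedCode F G L n d) (B : Splitting V F n y) (k : G.edgeSet) (i : V)
    (s : D.View y) : Fin (d i + y) → F :=
  s.1.2.2.2 i + Fin.append
    (∑ e, D.comb i e (D.proj (D.msgTwist k i e (s.1.1 e (s.2.1 e))) +
      D.projTwist k i e (s.1.2.1 e (s.2.2.1 e))))
    (s.2.2.2 + ∑ e, ∑ v, s.1.2.2.1 e v • B.part v (s.2.2.1 e) + B.part i (s.2.2.1 k))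

variable [Fintype F]

/-- The formula `ans` isolates the term `B.part i` of the desired mask, the only trace of `k` in the
second block. -/
lemma scheme_A (D : AlignedCode F G L n d) (B : Splitting V F n y) (hL : 0 < L)
    (k : G.edgeSet) (i : V) : (D.scheme B hL).A k i = D.ans B k i := by
  funext s
  change s.1.2.2.2 i + Fin.append _ _ = s.1.2.2.2 i + Fin.append _ _
  congr 2
  · refine Finset.sum_congr rfl fun e _ => ?_
    exact D.comb_stored i e (u := fun w => D.msgTwist k i e (s.1.1 e w)) (s.2.1 e) _
  · change s.2.2.2 + ∑ e, ∑ v, (s.1.2.2.1 e v + if e = k ∧ v = i then 1 else 0) •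
      B.part v (s.2.2.1 e) = _
    simp only [add_smul, Finset.sum_add_distrib, ite_smul, one_smul, zero_smul, ite_and]
    simp [add_assoc]

end AlignedCode

/-- The law of a scheme is the product of its three marginals. -/
lemma Scheme.law_apply [Fintype V] [Fintype F] [Fintype G.edgeSet] {R : Type} (S : Scheme F G R)
    (u : S.UserRand) (w : Messages F G S.L) (r : R) :
    S.law (u, w, r) =
      S.userLaw u * ((Nat.card (Messages F G S.L) : ENNReal)⁻¹ * S.randLaw r) := by
  classical
  have h1 (u' : S.UserRand) (w' : Messages F G S.L) :
      (S.randLaw.map fun r' => (u', w', r')) (u, w, r) =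
        if u' = u ∧ w' = w then S.randLaw r else 0 := by
    rw [PMF.map_apply, tsum_eq_single r]
    · simp only [Prod.mk.injEq, and_true, eq_comm]
    · intro r' hr
      simp [hr.symm]
  rw [Scheme.law, PMF.bind_apply, tsum_eq_single u]
  · rw [PMF.bind_apply, tsum_eq_single w]
    · let _ := Fintype.ofFinite (Messages F G S.L)
      rw [h1, PMF.uniformOfFintype_apply, ← Nat.card_eq_fintype_card, if_pos ⟨rfl, rfl⟩]
    · intro w' hw
      simp [h1, hw]
  · intro u' hu
    simp [h1, hu, PMF.bind_apply]

/-- The law of a scheme with uniform user randomness and uniform common randomness is uniform. -/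
lemma Scheme.law_eq_uniform [Fintype V] [Fintype F] [Fintype G.edgeSet] {R : Type}
    (S : Scheme F G R)
    [Fintype S.UserRand] [Nonempty S.UserRand] [Fintype R] [Nonempty R]
    [Fintype S.Sample] [Nonempty S.Sample]
    (hU : S.userLaw = PMF.uniformOfFintype _) (hR : S.randLaw = PMF.uniformOfFintype _) :
    S.law = PMF.uniformOfFintype S.Sample := by
  ext ⟨u, w, r⟩
  rw [S.law_apply, hU, hR]
  simp only [PMF.uniformOfFintype_apply, ← Nat.card_eq_fintype_card, Nat.card_prod, Nat.cast_mul]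
  rw [ENNReal.mul_inv (by simp) (by simp),
    ENNReal.mul_inv (by simp) (by simp)]

end Construction

/-! ### Privacy, reliability and parameters of the masked scheme. -/

lemma log_card_field_pos {F : Type} [Field F] [Fintype F] : 0 < Real.log (Fintype.card F) :=
  Real.log_pos (by exact_mod_cast Fintype.one_lt_card)

lemma append_add_inj {F : Type} [Field F] {m l : ℕ} {p : Fin (m + l) → F}
    {a a' : Fin m → F} {b b' : Fin l → F}
    (h : p + Fin.append a b = p + Fin.append a' b') : a = a' ∧ b = b' := by
  have h' := add_left_cancel h
  constructor
  · ext t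
    simpa using congrFun h' (Fin.castAdd l t)
  · ext t
    simpa using congrFun h' (Fin.natAdd m t)

namespace AlignedCode

open scoped Classical

variable {V F : Type} {G : SimpleGraph V} [Field F] [Fintype G.edgeSet]
  {L n y : ℕ} {d : V → ℕ} (D : AlignedCode F G L n d)

/-- The queries to a server for two desired messages differ by a symmetry. -/
lemma exists_translate_query (i : V) (k k' : G.edgeSet) :
    ∃ π : D.UserRand y → D.UserRand y, Function.Injective π ∧ ∀ u,
      (fun e => (π u).1 e ≪≫ₗ D.msgTwist k i e) = (fun e => u.1 e ≪≫ₗ D.msgTwist k' i e) ∧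
      (fun e => (π u).2.1 e ≪≫ₗ D.projTwist k i e) = (fun e => u.2.1 e ≪≫ₗ D.projTwist k' i e) ∧
      (fun e v => (π u).2.2.1 e v + if e = k ∧ v = i then 1 else 0) =
        (fun e v => u.2.2.1 e v + if e = k' ∧ v = i then 1 else 0) ∧
      (π u).2.2.2 = u.2.2.2 := by
  -- The twist or shift for `k'` is applied and the one for `k` is undone.
  refine ⟨fun u =>
    (fun e => u.1 e ≪≫ₗ D.msgTwist k' i e ≪≫ₗ (D.msgTwist k i e).symm,
      fun e => u.2.1 e ≪≫ₗ D.projTwist k' i e ≪≫ₗ (D.projTwist k i e).symm,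
      fun e v => (u.2.2.1 e v + if e = k' ∧ v = i then 1 else 0) -
        if e = k ∧ v = i then 1 else 0, u.2.2.2), ?_, fun u => ⟨?_, ?_, ?_, rfl⟩⟩
  · rintro ⟨P, Y, h, m⟩ ⟨P', Y', h', m'⟩ hs
    simp only [Prod.mk.injEq] at hs
    obtain ⟨h1, h2, h3, h4⟩ := hs
    have e1 : P = P' := by
      ext e w : 2
      simpa using LinearEquiv.congr_fun (congrFun h1 e) w
    have e2 : Y = Y' := by
      ext e w : 2
      simpa using LinearEquiv.congr_fun (congrFun h2 e) w
    have e3 : h = h' := by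
      ext e v
      simpa using congrFun (congrFun h3 e) v
    rw [e1, e2, e3, h4]
  · ext e w : 2
    simp
  · ext e w : 2
    simp
  · ext e v
    simp

variable [Fintype V] (B : Splitting V F n y)

/-- The user can decode the desired message. -/
lemma message_eq_of_ans_eq (k : G.edgeSet) (u : D.UserRand y) (w w' : G.edgeSet → Fin L → F)
    (r r' : D.CommonRand y) (h : ∀ i, D.ans B k i (u, w, r) = D.ans B k i (u, w', r')) :
    w k = w' k := by
  have h1 (i : V) := append_add_inj (h i)
  dsimp only at h1
  -- Comparison with the root's answer gives every part of the desired mask.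
  have hS : r.1 k = r'.1 k := by
    rw [← sub_eq_zero]
    refine B.ext_part _ fun v => ?_
    have hv := (h1 v).2
    have h0 := (h1 B.root).2
    rw [B.part_root, LinearMap.zero_apply, LinearMap.zero_apply, add_zero, add_zero] at h0
    rw [h0] at hv
    rw [map_sub, add_left_cancel hv, sub_self]
  -- Applied to differences: the desired mask cancels, and each undesired slot holds a projection
  -- plus a mask.
  have hw := D.decodable k (u.1 k (w k - w' k))
    (fun e => D.proj (u.1 e (w e - w' e)) + u.2.1 e (r.1 e - r'.1 e)) fun i => by
      rw [← sub_eq_zero.2 (h1 i).1, ← Finset.sum_sub_distrib]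
      refine Finset.sum_congr rfl fun e _ => ?_
      rw [← map_sub]
      by_cases he : e = k
      · subst he
        rw [if_pos rfl, hS]
        simp
      · rw [if_neg he, D.proj_msgTwist k i e he, D.proj_msgTwist k i e he]
        simp only [map_sub, map_add]
        abel
  rw [map_eq_zero_iff _ (u.1 k).injective, sub_eq_zero] at hw
  exact hw

/-- A change of the undesired messages is compensated by a change of the common randomness. -/
lemma exists_translate_messages (k : G.edgeSet) (δ : {e : G.edgeSet // e ≠ k} → Fin L → F) :
    ∃ π : D.View y → D.View y, Function.Injective π ∧ ∀ s,
      (fun e : {e : G.edgeSet // e ≠ k} => (π s).2.1 e.1) = (fun e => s.2.1 e.1) + δ ∧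
        (fun i => D.ans B k i (π s)) = (fun i => D.ans B k i s) ∧ (π s).1 = s.1 := by
  let ε : G.edgeSet → Fin L → F := fun e => if h : e ≠ k then δ ⟨e, h⟩ else 0
  have hε : ε k = 0 := by simp [ε]
  -- By alignment `a` does not depend on the server, so lowering the mask by `a` cancels the change
  -- `ε` everywhere at once. The shared vector absorbs the effect on mask retrieval, and `a u k = 0`
  -- keeps the desired mask.
  let a (u : D.UserRand y) (e : G.edgeSet) : Fin n → F := (u.2.1 e).symm (D.proj (u.1 e (ε e)))
  have ha (u) : a u k = 0 := by simp [a, hε]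
  refine ⟨fun s =>
    (s.1, s.2.1 + ε, s.2.2.1 - a s.1, s.2.2.2 + ∑ e, ∑ v, s.1.2.2.1 e v • B.part v (a s.1 e)),
    ?_, fun s => ⟨?_, ?_, rfl⟩⟩
  · rintro ⟨u, w, r⟩ ⟨u', w', r'⟩ hs
    simp only [Prod.mk.injEq] at hs
    obtain ⟨rfl, h1, h2, h3⟩ := hs
    rw [add_right_cancel h1, Prod.ext (sub_left_injective h2) (add_right_cancel h3)]
  · ext1 e
    simp [ε, e.2]
  · ext1 i
    rw [ans, ans]
    congr 2
    · refine Finset.sum_congr rfl fun e _ => ?_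
      dsimp only [Pi.add_apply, Pi.sub_apply]
      by_cases he : e = k
      · subst he
        rw [hε, ha, add_zero, sub_zero]
      · rw [D.proj_msgTwist k i e he, D.proj_msgTwist k i e he]
        simp only [map_sub, map_add, a, LinearEquiv.apply_symm_apply]
        abel
    · dsimp only [Pi.add_apply, Pi.sub_apply]
      rw [ha, sub_zero]
      simp only [map_sub, smul_sub, Finset.sum_sub_distrib]
      abel

/-- The answers are translated by translating the pads. -/
lemma exists_translate_ans (k : G.edgeSet) (i : V) (δ : Fin (d i + y) → F) :
    ∃ π : D.View y → D.View y, Function.Injective π ∧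
      ∀ s, D.ans B k i (π s) = D.ans B k i s + δ := by
  let ε : (j : V) → Fin (d j + y) → F := Function.update 0 i δ
  refine ⟨fun s => ((s.1.1, s.1.2.1, s.1.2.2.1, s.1.2.2.2 + ε), s.2), ?_, fun s => ?_⟩
  · rintro ⟨⟨P, Y, h, m⟩, s⟩ ⟨⟨P', Y', h', m'⟩, s'⟩ hs
    simp only [Prod.mk.injEq] at hs
    obtain ⟨⟨rfl, rfl, rfl, h4⟩, rfl⟩ := hs
    rw [add_right_cancel h4]
  · have : ε i = δ := by simp [ε]
    simp only [ans, Pi.add_apply, this]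
    abel

variable [Fintype F] (hL : 0 < L)

noncomputable instance : Fintype (D.scheme B hL).Sample :=
  Fintype.ofFinite (D.View y)

instance : Nonempty (D.scheme B hL).Sample :=
  ⟨((fun _ => LinearEquiv.refl _ _, fun _ => LinearEquiv.refl _ _, 0, 0), 0, 0, 0)⟩

lemma scheme_law : (D.scheme B hL).law = PMF.uniformOfFintype (D.scheme B hL).Sample := by
  let _ : Fintype (D.scheme B hL).UserRand :=
    haveI := (D.scheme B hL).finite_userRand
    Fintype.ofFinite _
  have : Nonempty (D.scheme B hL).UserRand :=
    ⟨(fun _ => LinearEquiv.refl _ _, fun _ => LinearEquiv.refl _ _, 0, 0)⟩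
  exact Scheme.law_eq_uniform _ rfl rfl

lemma scheme_userPrivacy : (D.scheme B hL).UserPrivacy := by
  intro i k k'
  obtain ⟨π, hπ, h⟩ := D.exists_translate_query (y := y) i k k'
  let π' : (D.scheme B hL).Sample → (D.scheme B hL).Sample := fun s => (π s.1, s.2)
  have hπ' : Function.Injective π' := by
    rintro ⟨u, s⟩ ⟨u', s'⟩ hs
    obtain ⟨h1, h2⟩ := Prod.mk.inj hs
    exact Prod.ext (hπ h1) h2
  have hQ (s) : (D.scheme B hL).Q k i (π' s) = (D.scheme B hL).Q k' i s :=
    Prod.ext (h s.1).1 (Prod.ext (h s.1).2.1 (Prod.ext (h s.1).2.2.1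
      (congrFun (h s.1).2.2.2 i)))
  rw [scheme_law, ← map_uniform_comp _ hπ']
  congr 1
  ext s : 1
  have hA : (D.scheme B hL).A k i (π' s) = (D.scheme B hL).A k' i s := by
    unfold Scheme.A
    rw [hQ]
    rfl
  rw [hQ, hA]
  rfl

lemma scheme_reliable : (D.scheme B hL).Reliable := by
  intro k
  apply condEntropy_eq_zero_of_function
  rintro ⟨u, w, r⟩ ⟨u', w', r'⟩ h
  obtain ⟨hA, hU⟩ := Prod.mk.inj h
  obtain rfl : u = u' := hU
  refine D.message_eq_of_ans_eq B k u w w' r r' fun i => ?_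
  have := congrFun hA i
  simp only [Scheme.AAll, scheme_A] at this
  exact this

lemma scheme_AAll (k : G.edgeSet) : (D.scheme B hL).AAll k = fun s i => D.ans B k i s := by
  funext s i
  exact congrFun (D.scheme_A B hL k i) s

/-- The undesired messages are uniform given the user's randomness, with or without the answers, so
both conditional entropies have the same value. -/
lemma scheme_databasePrivacy : (D.scheme B hL).DatabasePrivacy := by
  intro k
  let _ : AddGroup ({e : G.edgeSet // e ≠ k} → Fin (D.scheme B hL).L → F) := Pi.addGroup
  rw [condMutualInfo, scheme_law, condEntropy_uniform, condEntropy_uniform, sub_self]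
  · intro δ
    obtain ⟨π, h1, h2⟩ := D.exists_translate_messages B k δ
    rw [scheme_AAll]
    exact ⟨π, h1, fun s => ⟨(h2 s).1, Prod.ext (h2 s).2.1 (h2 s).2.2⟩⟩
  · intro δ
    obtain ⟨π, h1, h2⟩ := D.exists_translate_messages B k δ
    exact ⟨π, h1, fun s => ⟨(h2 s).1, (h2 s).2.2⟩⟩

lemma scheme_isSPIR : (D.scheme B hL).IsSPIR :=
  ⟨D.scheme_userPrivacy B hL, D.scheme_reliable B hL, D.scheme_databasePrivacy B hL⟩

lemma scheme_entropy_A (k : G.edgeSet) (i : V) :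
    entropy (Fintype.card F) (D.scheme B hL).law ((D.scheme B hL).A k i) = d i + y := by
  let _ : AddGroup (Fin ((D.scheme B hL).len i) → F) := Pi.addGroup
  rw [scheme_law, entropy_uniform]
  · have hc : Fintype.card (Fin ((D.scheme B hL).len i) → F) = Fintype.card F ^ (d i + y) := by
      rw [Fintype.card_fun, Fintype.card_fin]
      rfl
    rw [hc, Nat.cast_pow, Real.log_pow, mul_div_assoc, div_self log_card_field_pos.ne']
    push_cast
    ring
  · intro δ
    rw [scheme_A]
    exact D.exists_translate_ans B k i δ

lemma scheme_entropy_rand :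
    entropy (Fintype.card F) (D.scheme B hL).law (D.scheme B hL).Rand =
      Fintype.card G.edgeSet * n + y := by
  rw [scheme_law, entropy_uniform]
  · have hc : Fintype.card (D.CommonRand y) =
        Fintype.card F ^ (n * Fintype.card G.edgeSet + y) := by
      simp only [Fintype.card_prod, Fintype.card_fun, Fintype.card_fin]
      rw [pow_add, pow_mul]
    rw [hc, Nat.cast_pow, Real.log_pow, mul_div_assoc, div_self log_card_field_pos.ne']
    push_cast
    ring
  · intro δ
    refine ⟨fun s => (s.1, s.2.1, s.2.2 + δ), ?_, fun s => rfl⟩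
    rintro ⟨u, w, r⟩ ⟨u', w', r'⟩ hs
    obtain ⟨h1, h2⟩ := Prod.mk.inj hs
    obtain ⟨h2, h3⟩ := Prod.mk.inj h2
    exact Prod.ext h1 (Prod.ext h2 (add_right_cancel h3))

lemma scheme_rate (k : G.edgeSet) :
    (D.scheme B hL).rate k = L / (∑ i, (d i : ℝ) + Fintype.card V * y) := by
  rw [Scheme.rate]
  simp only [scheme_entropy_A, Finset.sum_add_distrib, Finset.sum_const, Finset.card_univ,
    nsmul_eq_mul]
  rfl

lemma scheme_totalRandRatio :
    (D.scheme B hL).totalRandRatio = (Fintype.card G.edgeSet * n + y) / L := by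
  rw [Scheme.totalRandRatio, scheme_entropy_rand]
  rfl

end AlignedCode

/-! ### Pairs of surjective linear maps. -/

section LinearAlgebra

variable {F U E : Type} [Field F] [AddCommGroup U] [Module F U] [FiniteDimensional F U]
  [AddCommGroup E] [Module F E] [FiniteDimensional F E]

/-- A surjection identifies its source with the product of its kernel and its target. -/
lemma exists_equiv_ker_prod (H : U →ₗ[F] E) (hH : Function.Surjective H) :
    ∃ φ : U ≃ₗ[F] (LinearMap.ker H × E), ∀ u, (φ u).2 = H u := by
  obtain ⟨p, hp⟩ := (LinearMap.ker H).subtype.exists_leftInverse_of_injective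
    (LinearMap.ker_eq_bot.2 (Submodule.subtype_injective _))
  have hinj : Function.Injective (p.prod H) := by
    rw [injective_iff_map_eq_zero]
    intro u hu
    obtain ⟨h1, h2⟩ := Prod.mk.inj hu
    have h3 := LinearMap.congr_fun hp ⟨u, h2⟩
    change p u = ⟨u, h2⟩ at h3
    exact congrArg Subtype.val (h3.symm.trans h1)
  have hdim : Module.finrank F U = Module.finrank F (LinearMap.ker H × E) := by
    rw [Module.finrank_prod, ← LinearMap.finrank_range_add_finrank_ker H,
      LinearMap.range_eq_top.2 hH, finrank_top, add_comm]
  exact ⟨LinearMap.linearEquivOfInjective _ hinj hdim, fun u => rfl⟩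

/-- Two surjections with the same source and target differ by an automorphism of the source. -/
lemma exists_equiv_comp_eq {H H' : U →ₗ[F] E} (hH : Function.Surjective H)
    (hH' : Function.Surjective H') : ∃ c : U ≃ₗ[F] U, ∀ u, H (c u) = H' u := by
  obtain ⟨φ, hφ⟩ := exists_equiv_ker_prod H hH
  obtain ⟨φ', hφ'⟩ := exists_equiv_ker_prod H' hH'
  have h1 := LinearMap.finrank_range_add_finrank_ker H
  have h2 := LinearMap.finrank_range_add_finrank_ker H'
  rw [LinearMap.range_eq_top.2 hH] at h1
  rw [LinearMap.range_eq_top.2 hH'] at h2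
  let κ : LinearMap.ker H' ≃ₗ[F] LinearMap.ker H := LinearEquiv.ofFinrankEq _ _ (by omega)
  refine ⟨φ' ≪≫ₗ κ.prodCongr (LinearEquiv.refl F E) ≪≫ₗ φ.symm, fun u => ?_⟩
  rw [← hφ, ← hφ']
  simp

/-- Two surjections with the same source and target restrict to bijections on a common subspace. -/
lemma exists_common_section {X Y : U →ₗ[F] E} (hX : Function.Surjective X)
    (hY : Function.Surjective Y) :
    ∃ s : E →ₗ[F] U, Function.Bijective (X ∘ₗ s) ∧ Function.Bijective (Y ∘ₗ s) := by
  -- Inside `C` the two kernels have traces of equal dimension, identified by `φ` below. The graph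
  -- `{a + φ a}` plus a complement `Z` of the sum of the kernels meets each kernel trivially and has
  -- the dimension of `E`. This works over every field, however small.
  obtain ⟨C, hC⟩ := (LinearMap.ker X ⊓ LinearMap.ker Y).exists_isCompl
  obtain ⟨Z, hZ⟩ := (LinearMap.ker X ⊔ LinearMap.ker Y).exists_isCompl
  have h1 := LinearMap.finrank_range_add_finrank_ker X
  have h2 := LinearMap.finrank_range_add_finrank_ker Y
  rw [LinearMap.range_eq_top.2 hX, finrank_top] at h1
  rw [LinearMap.range_eq_top.2 hY, finrank_top] at h2
  have h3 := Submodule.finrank_sup_add_finrank_inf_eq (LinearMap.ker X) (LinearMap.ker Y)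
  have h4 := Submodule.finrank_add_eq_of_isCompl hZ
  have hdim (K : Submodule F U) (hK : LinearMap.ker X ⊓ LinearMap.ker Y ≤ K) :
      Module.finrank F (C ⊓ K : Submodule F U) +
        Module.finrank F (LinearMap.ker X ⊓ LinearMap.ker Y : Submodule F U) =
          Module.finrank F K := by
    have h := Submodule.finrank_sup_add_finrank_inf_eq (C ⊓ K)
      (LinearMap.ker X ⊓ LinearMap.ker Y)
    have hbot : C ⊓ K ⊓ (LinearMap.ker X ⊓ LinearMap.ker Y) = ⊥ :=
      (hC.symm.disjoint.mono_left inf_le_left).eq_bot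
    have htop : C ⊓ K ⊔ LinearMap.ker X ⊓ LinearMap.ker Y = K := by
      rw [sup_comm, ← sup_inf_assoc_of_le C hK, hC.sup_eq_top, top_inf_eq]
    rw [hbot, htop, finrank_bot, add_zero] at h
    exact h.symm
  have hA := hdim _ inf_le_left
  have hB := hdim _ inf_le_right
  let φ : (C ⊓ LinearMap.ker X : Submodule F U) ≃ₗ[F] (C ⊓ LinearMap.ker Y : Submodule F U) :=
    LinearEquiv.ofFinrankEq _ _ (by omega)
  let ψ : E ≃ₗ[F] ((C ⊓ LinearMap.ker X : Submodule F U) × Z) :=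
    LinearEquiv.ofFinrankEq _ _ (by rw [Module.finrank_prod]; omega)
  let s : ((C ⊓ LinearMap.ker X : Submodule F U) × Z) →ₗ[F] U :=
    (Submodule.subtype _ + Submodule.subtype _ ∘ₗ φ.toLinearMap).coprod Z.subtype
  have hs (a z) : s (a, z) = a + φ a + z := rfl
  have hsZ (a z) (K : Submodule F U) (hK : K ≤ LinearMap.ker X ⊔ LinearMap.ker Y)
      (h : s (a, z) ∈ K) : z = 0 := by
    have hz : (z : U) ∈ LinearMap.ker X ⊔ LinearMap.ker Y := by
      have : (z : U) = s (a, z) - (a + φ a) := by rw [hs]; abel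
      rw [this]
      exact Submodule.sub_mem _ (hK h) (Submodule.add_mem _
        (Submodule.mem_sup_left a.2.2) (Submodule.mem_sup_right (φ a).2.2))
    exact Subtype.ext (Submodule.disjoint_def.1 hZ.disjoint _ hz z.2)
  have hCK {v : U} (hv : v ∈ C) (hvX : X v = 0) (hvY : Y v = 0) : v = 0 :=
    Submodule.disjoint_def.1 hC.disjoint v ⟨hvX, hvY⟩ hv
  have hbij (K : U →ₗ[F] E) (h : ∀ p, K (s p) = 0 → p = 0) :
      Function.Bijective (K ∘ₗ (s ∘ₗ ψ.toLinearMap)) := by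
    have hinj : Function.Injective (K ∘ₗ (s ∘ₗ ψ.toLinearMap)) := by
      rw [injective_iff_map_eq_zero]
      intro e he
      exact (map_eq_zero_iff _ ψ.injective).1 (h (ψ e) he)
    exact ⟨hinj, LinearMap.injective_iff_surjective.1 hinj⟩
  refine ⟨s ∘ₗ ψ.toLinearMap, hbij X ?_, hbij Y ?_⟩
  · rintro ⟨a, z⟩ h
    obtain rfl := hsZ a z _ le_sup_left h
    have h5 : X (φ a) = 0 := by
      have : X a = 0 := a.2.2
      simpa [hs, this] using h
    have h6 : φ a = 0 := Subtype.ext (hCK (φ a).2.1 h5 (φ a).2.2)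
    rw [(map_eq_zero_iff _ φ.injective).1 h6]
    rfl
  · rintro ⟨a, z⟩ h
    obtain rfl := hsZ a z _ le_sup_right h
    have h5 : Y a = 0 := by
      have : Y (φ a) = 0 := (φ a).2.2
      simpa [hs, this] using h
    have h6 : a = 0 := Subtype.ext (hCK a.2.1 a.2.2 h5)
    rw [h6]
    rfl

end LinearAlgebra

/-! ### Alignment of undesired messages, and splitting of masks. -/

/-- Linear retrieval data with surjective projections can be aligned. -/
lemma exists_alignedCode {V F : Type} {G : SimpleGraph V} [Field F] [Fintype G.edgeSet]
    {L n : ℕ} {d : V → ℕ} (hnL : n ≤ L)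
    (comb : (i : V) → G.edgeSet → (Fin n → F) →ₗ[F] (Fin (d i) → F))
    (hcomb : ∀ i (e : G.edgeSet), i ∉ (e : Sym2 V) → comb i e = 0)
    (X : G.edgeSet → V → G.edgeSet → (Fin L → F) →ₗ[F] (Fin n → F))
    (hX : ∀ k i (e : G.edgeSet), i ∈ (e : Sym2 V) → Function.Surjective (X k i e))
    (hdec : ∀ k (W : G.edgeSet → Fin L → F), (∀ i, ∑ e, comb i e (X k i e (W e)) = 0) → W k = 0) :
    Nonempty (AlignedCode F G L n d) := by
  classical
  let proj : (Fin L → F) →ₗ[F] (Fin n → F) := LinearMap.funLeft F F (Fin.castLE hnL)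
  have hproj : Function.Surjective proj :=
    LinearMap.funLeft_surjective_of_injective F F _ (Fin.castLE_injective hnL)
  -- An edge has just two endpoints, so a common section of two surjections suffices.
  have hs (k e : G.edgeSet) : ∃ s : (Fin n → F) →ₗ[F] (Fin L → F),
      ∀ i ∈ (e : Sym2 V), Function.Bijective (X k i e ∘ₗ s) := by
    obtain ⟨e, he⟩ := e
    induction e using Sym2.ind with
    | _ a b =>
      obtain ⟨s, ha, hb⟩ := exists_common_section (hX k a ⟨s(a, b), he⟩ (Sym2.mem_mk_left a b))
        (hX k b ⟨s(a, b), he⟩ (Sym2.mem_mk_right a b))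
      refine ⟨s, fun i hi => ?_⟩
      rcases Sym2.mem_iff.1 hi with rfl | rfl
      · exact ha
      · exact hb
  choose s hs using hs
  -- The desired message is still seen through `X`. An undesired `w` is treated as if it were `s
  -- (proj w)`: its view is `X ∘ s`, an automorphism, after `proj`.
  have htw (k : G.edgeSet) (i : V) (e : G.edgeSet) :
      ∃ (c : (Fin L → F) ≃ₗ[F] (Fin L → F)) (g : (Fin n → F) ≃ₗ[F] (Fin n → F)),
        (e ≠ k → ∀ w, proj (c w) = g (proj w)) ∧
        (e ≠ k → i ∈ (e : Sym2 V) → ∀ z, g z = X k i e (s k e z)) ∧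
        (e = k → i ∈ (e : Sym2 V) → ∀ w, proj (c w) = X k i e w) := by
    by_cases hi : i ∈ (e : Sym2 V)
    · by_cases he : e = k
      · obtain ⟨c, hc⟩ := exists_equiv_comp_eq hproj (hX k i e hi)
        exact ⟨c, LinearEquiv.refl _ _, fun h => absurd he h, fun h => absurd he h,
          fun _ _ => hc⟩
      · let g := LinearEquiv.ofBijective _ (hs k e i hi)
        have hg : Function.Surjective (g.toLinearMap ∘ₗ proj) := g.surjective.comp hproj
        obtain ⟨c, hc⟩ := exists_equiv_comp_eq hproj hg
        exact ⟨c, g, fun _ => hc, fun _ _ _ => rfl, fun h => absurd h he⟩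
    · exact ⟨LinearEquiv.refl _ _, LinearEquiv.refl _ _, fun _ _ => rfl, fun _ h => absurd h hi,
        fun _ h => absurd h hi⟩
  choose c g h1 h2 h3 using htw
  refine ⟨⟨comb, hcomb, proj, c, g, h1, fun k w z h => ?_⟩⟩
  have := hdec k (fun e => if e = k then w else s k e (z e)) fun i => by
    rw [← h i]
    refine Finset.sum_congr rfl fun e _ => ?_
    by_cases hi : i ∈ (e : Sym2 V)
    · by_cases he : e = k
      · rw [if_pos he, if_pos he, h3 k i e he hi]
      · rw [if_neg he, if_neg he, h2 k i e he hi]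
    · rw [hcomb i e hi, LinearMap.zero_apply, LinearMap.zero_apply]
  simpa using this

/-- A vector splits into equal parts, one for each server but one. -/
lemma exists_splitting {V F : Type} [Field F] [Fintype V] [Nonempty V] (y : ℕ) :
    Nonempty (Splitting V F ((Fintype.card V - 1) * y) y) := by
  classical
  let v₀ : V := Classical.arbitrary V
  let φ : {v // v ≠ v₀} × Fin y ≃ Fin ((Fintype.card V - 1) * y) :=
    Fintype.equivFinOfCardEq (by simp [Fintype.card_subtype_compl])
  refine ⟨⟨v₀, fun v => if h : v ≠ v₀ then LinearMap.funLeft F F fun t => φ (⟨v, h⟩, t) else 0,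
    by simp, fun s hs => ?_⟩⟩
  ext t
  obtain ⟨⟨⟨v, hv⟩, t⟩, rfl⟩ := φ.surjective t
  have := congrFun (hs v) t
  rw [dif_pos hv] at this
  exact this

/-! ### Replacing real probabilities by integer multiplicities. -/

section Rationality

/-- Finitely many positive reals are mapped to positive rationals by some `ℚ`-linear map. -/
lemma exists_rat_linearMap_pos {ι : Type} [Finite ι] (x : ι → ℝ) :
    ∃ φ : ℝ →ₗ[ℚ] ℚ, ∀ i, 0 < x i → 0 < φ (x i) := by
  let H : Submodule ℚ ℝ := Submodule.span ℚ (Set.range x)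
  have : FiniteDimensional ℚ H := FiniteDimensional.span_of_finite ℚ (Set.finite_range x)
  let b := Module.finBasis ℚ H
  let v (i : ι) : H := ⟨x i, Submodule.subset_span ⟨i, rfl⟩⟩
  let g (i : ι) (t : Fin (Module.finrank ℚ H) → ℝ) : ℝ := ∑ j, (b.repr (v i) j : ℝ) * t j
  have hg0 (i : ι) : g i (fun j => (b j : ℝ)) = x i := by
    have h := congrArg (Subtype.val) (b.sum_repr (v i))
    rw [AddSubmonoidClass.coe_finsetSum] at h
    change _ = x i at h
    rw [← h]
    refine Finset.sum_congr rfl fun j _ => ?_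
    rw [Submodule.coe_smul, Rat.smul_def]
  have hcont (i : ι) : Continuous (g i) := by
    fun_prop
  have hopen : IsOpen {t | ∀ i, 0 < x i → 0 < g i t} := by
    simp only [Set.ofPred_forall]
    refine isOpen_iInter_of_finite fun i => isOpen_iInter_of_finite fun _ => ?_
    exact isOpen_lt continuous_const (hcont i)
  -- Positivity is an open condition on the images of the basis and holds at the basis itself, hence
  -- also at some rational point.
  have hdense : DenseRange (Pi.map fun (_ : Fin (Module.finrank ℚ H)) (r : ℚ) => (r : ℝ)) :=
    DenseRange.piMap fun _ => Rat.denseRange_cast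
  obtain ⟨t, ht⟩ := hdense.exists_mem_open hopen ⟨fun j => (b j : ℝ), fun i hi => by
    rw [hg0]; exact hi⟩
  obtain ⟨φ, hφ⟩ := LinearMap.exists_extend (b.constr ℚ t)
  refine ⟨φ, fun i hi => ?_⟩
  have h1 : φ (x i) = b.constr ℚ t (v i) := by
    rw [← hφ]; rfl
  have h2 := ht i hi
  rw [h1, Module.Basis.constr_apply_fintype]
  have h3 : ((∑ j, b.equivFun (v i) j • t j : ℚ) : ℝ) =
      g i (Pi.map (fun _ (r : ℚ) => (r : ℝ)) t) := by
    push_cast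
    refine Finset.sum_congr rfl fun j _ => ?_
    simp
  rw [← h3] at h2
  exact_mod_cast h2

/-- A finite nonnegative real family has a nonnegative integral counterpart with the same support
that satisfies all its integral linear relations. -/
lemma exists_nat_weights {ι : Type} [Fintype ι] (x : ι → ℝ) (hx : ∀ i, 0 ≤ x i) :
    ∃ m : ι → ℕ, (∀ i, m i ≠ 0 ↔ x i ≠ 0) ∧
      ∀ c : ι → ℤ, ∑ i, c i * x i = 0 → ∑ i, c i * (m i : ℤ) = 0 := by
  obtain ⟨φ, hφ⟩ := exists_rat_linearMap_pos x
  have hφ0 (i : ι) : 0 ≤ φ (x i) := by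
    rcases (hx i).eq_or_lt with h | h
    · rw [← h, map_zero]
    · exact (hφ i h).le
  let D : ℕ := ∏ i, (φ (x i)).den
  have hD : (D : ℚ) ≠ 0 := by
    rw [Nat.cast_ne_zero]
    exact Finset.prod_ne_zero_iff.2 fun i _ => (φ (x i)).den_ne_zero
  have hm (i : ι) : ∃ m : ℕ, (m : ℚ) = D * φ (x i) := by
    obtain ⟨r, hr⟩ : (φ (x i)).den ∣ D := Finset.dvd_prod_of_mem _ (Finset.mem_univ i)
    refine ⟨r * (φ (x i)).num.toNat, ?_⟩
    have h1 : (((φ (x i)).num.toNat : ℕ) : ℚ) = (φ (x i)).num := by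
      have := Int.toNat_of_nonneg (Rat.num_nonneg.2 (hφ0 i))
      exact_mod_cast this
    have h2 := Rat.den_mul_eq_num (φ (x i))
    rw [hr]
    push_cast
    rw [h1, ← h2]
    ring
  choose m hm using hm
  refine ⟨m, fun i => not_congr ?_, fun c hc => ?_⟩
  · rw [← Nat.cast_eq_zero (R := ℚ), hm, mul_eq_zero, or_iff_right hD]
    refine ⟨fun h => ?_, fun h => by rw [h, map_zero]⟩
    by_contra hne
    exact (hφ i ((hx i).lt_of_ne' hne)).ne' h
  · have h1 : ∑ i, (c i : ℚ) * φ (x i) = 0 := by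
      rw [← map_zero φ, ← hc, map_sum]
      refine Finset.sum_congr rfl fun i _ => ?_
      rw [← zsmul_eq_mul, ← zsmul_eq_mul, map_zsmul]
    have h2 : ((∑ i, c i * (m i : ℤ) : ℤ) : ℚ) = 0 := by
      push_cast
      simp_rw [hm]
      rw [← mul_zero (D : ℚ), ← h1, Finset.mul_sum]
      exact Finset.sum_congr rfl fun i _ => by ring
    exact_mod_cast h2

/-- A finite sample on which all integral linear relations between the probabilities hold. -/
lemma exists_balanced_sample {Ω : Type} [Fintype Ω] (p : PMF Ω) {N : ℕ} (hN : 0 < N) :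
    ∃ (I : Type) (_ : Fintype I) (_ : Nonempty I) (τ : I → Ω), N ∣ Fintype.card I ∧
      (∀ j, p (τ j) ≠ 0) ∧
      ∀ c : Ω → ℤ, ∑ u, c u * (p u).toReal = 0 → ∑ j, c (τ j) = 0 := by
  obtain ⟨m, hm, hc⟩ := exists_nat_weights (fun u => (p u).toReal) fun u => ENNReal.toReal_nonneg
  have hp (u : Ω) : m u ≠ 0 ↔ p u ≠ 0 := by
    rw [hm, ENNReal.toReal_ne_zero]
    exact and_iff_left (p.apply_ne_top u)
  obtain ⟨u, hu⟩ := p.support_nonempty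
  -- Each `u` is repeated `m u` times; the factor `Fin N` gives divisibility without changing
  -- proportions.
  refine ⟨(Σ u, Fin (m u)) × Fin N, inferInstance,
    ⟨(⟨u, ⟨0, Nat.pos_of_ne_zero ((hp u).2 hu)⟩⟩, ⟨0, hN⟩)⟩, fun j => j.1.1, ?_, ?_, ?_⟩
  · rw [Fintype.card_prod, Fintype.card_fin]
    exact dvd_mul_left _ _
  · rintro ⟨⟨u, t⟩, -⟩
    exact (hp u).1 (Nat.pos_iff_ne_zero.1 t.pos)
  · intro c h
    have h1 := hc c h
    rw [Fintype.sum_prod_type]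
    simp only [Finset.sum_const, Finset.card_univ, Fintype.card_fin]
    rw [← Finset.smul_sum, Fintype.sum_sigma]
    simp only [Finset.sum_const, Finset.card_univ, Fintype.card_fin, nsmul_eq_mul]
    simp_rw [mul_comm (c _)] at h1
    rw [h1, mul_zero]

end Rationality

/-! ### Linear PIR schemes: edge maps, query laws and mean ranks. -/

section PIR

open scoped Classical

lemma ite_congr_iff {α : Type*} {p q : Prop} {_ : Decidable p} {_ : Decidable q} (h : p ↔ q)
    (a b : α) : (if p then a else b) = if q then a else b :=
  if_congr h rfl rfl

variable {V F : Type} {G : SimpleGraph V} [Field F]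

/-- The answer of server `i` to a query as a linear function of the database. -/
def Scheme.answerMap {T : Scheme F G Unit} (hlin : T.IsLinear) (i : V) (q : T.Query i) :
    Messages F G T.L →ₗ[F] (Fin (T.len i) → F) :=
  (hlin i q).mk' _ ∘ₗ LinearMap.funLeft F (Fin T.L → F) (fun e : Stored G i => e.1)

/-- The part of an answer that depends on the message of one edge. -/
noncomputable def Scheme.edgeMap {T : Scheme F G Unit} (hlin : T.IsLinear) (i : V) (q : T.Query i)
    (e : G.edgeSet) : (Fin T.L → F) →ₗ[F] (Fin (T.len i) → F) :=
  Scheme.answerMap hlin i q ∘ₗ LinearMap.single F (fun _ => Fin T.L → F) e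

lemma Scheme.edgeMap_eq_zero {T : Scheme F G Unit} (hlin : T.IsLinear) (i : V) (q : T.Query i)
    (e : G.edgeSet) (hi : i ∉ (e : Sym2 V)) : Scheme.edgeMap hlin i q e = 0 := by
  refine LinearMap.ext fun w => ?_
  have : LinearMap.funLeft F (Fin T.L → F) (fun e : Stored G i => e.1)
      (Pi.single e w : G.edgeSet → Fin T.L → F) = 0 := by
    ext1 e'
    have hne : e'.1 ≠ e := fun h => hi (h ▸ e'.2)
    change (Pi.single e w : G.edgeSet → Fin T.L → F) e'.1 = 0
    rw [Pi.single_eq_of_ne hne]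
  change (hlin i q).mk' _ (LinearMap.funLeft F (Fin T.L → F) (fun e : Stored G i => e.1)
      (Pi.single e w : G.edgeSet → Fin T.L → F)) = 0
  rw [this, map_zero]

lemma Scheme.answerMap_eq_sum [Fintype G.edgeSet] {T : Scheme F G Unit} (hlin : T.IsLinear)
    (i : V) (q : T.Query i) (w : Messages F G T.L) :
    Scheme.answerMap hlin i q w = ∑ e, Scheme.edgeMap hlin i q e (w e) := by
  conv_lhs => rw [← Finset.univ_sum_single w, map_sum]
  rfl

/-- Fibres of a linear map split evenly under a second linear map. -/
lemma card_fiber_eq {F M A B : Type} [Field F] [Fintype F] [AddCommGroup M] [Module F M] [Finite M]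
    [AddCommGroup A] [Module F A] [AddCommGroup B] [Module F B] (f : M →ₗ[F] A) (g : M →ₗ[F] B)
    (m₀ : M) :
    Nat.card {m // f m = f m₀} =
      Fintype.card F ^ Module.finrank F (LinearMap.range (g ∘ₗ (LinearMap.ker f).subtype)) *
        Nat.card {m // f m = f m₀ ∧ g m = g m₀} := by
  have e1 : {m // f m = f m₀} ≃ LinearMap.ker f :=
    (Equiv.subRight m₀).subtypeEquiv fun m => by simp [sub_eq_zero]
  have e2 : {m // f m = f m₀ ∧ g m = g m₀} ≃
      LinearMap.ker (g ∘ₗ (LinearMap.ker f).subtype) :=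
    { toFun := fun m => ⟨⟨m.1 - m₀, by simp [m.2.1]⟩, by simp [m.2.2]⟩
      invFun := fun m => ⟨m.1.1 + m₀, by
        have h1 : f m.1.1 = 0 := m.1.2
        have h2 : g m.1.1 = 0 := m.2
        simp [h1, h2]⟩
      left_inv := fun m => by simp
      right_inv := fun m => by simp }
  rw [Nat.card_congr e1, Nat.card_congr e2, Module.natCard_eq_pow_finrank (K := F),
    Module.natCard_eq_pow_finrank (K := F) (V := LinearMap.ker (g ∘ₗ (LinearMap.ker f).subtype)),
    Nat.card_eq_fintype_card, ← pow_add, LinearMap.finrank_range_add_finrank_ker]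

variable [Fintype V] [Fintype F]

lemma Scheme.map_law_fst (T : Scheme F G Unit) : T.law.map Prod.fst = T.userLaw := by
  rw [Scheme.law, PMF.map_bind]
  simp only [PMF.map_bind, PMF.map_comp]
  have (u : T.UserRand) (w : Messages F G T.L) :
      PMF.map (Prod.fst ∘ fun r => (u, w, r)) T.randLaw = PMF.pure u :=
    PMF.map_const _ _
  simp only [this, PMF.bind_const, PMF.bind_pure]

lemma Scheme.entropy_W (T : Scheme F G Unit) (k : G.edgeSet) :
    entropy (Fintype.card F) T.law (T.W k) = T.L := by
  let _ := Fintype.ofFinite (Messages F G T.L)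
  have h1 : T.law.map (fun s => s.2.1) = PMF.uniformOfFintype (Messages F G T.L) := by
    rw [Scheme.law, PMF.map_bind]
    simp only [PMF.map_bind, PMF.map_comp]
    have (u : T.UserRand) (w : Messages F G T.L) :
        PMF.map ((fun s : T.Sample => s.2.1) ∘ fun r => (u, w, r)) T.randLaw = PMF.pure w :=
      PMF.map_const _ _
    simp only [this, PMF.bind_const, PMF.bind_pure]
  have h2 : entropy (Fintype.card F) T.law (T.W k) =
      entropy (Fintype.card F) (PMF.uniformOfFintype (Messages F G T.L)) fun w => w k := by
    rw [entropy, entropy, ← h1, PMF.map_comp]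
    rfl
  rw [h2, entropy_uniform]
  · rw [Fintype.card_fun, Fintype.card_fin, Nat.cast_pow, Real.log_pow, mul_div_assoc,
      div_self log_card_field_pos.ne', mul_one]
  · intro δ
    refine ⟨fun w => w + Pi.single k δ, add_left_injective _, fun w => ?_⟩
    simp

/-- A server's query has the same law for any two desired messages. -/
lemma Scheme.UserPrivacy.sum_query_eq {T : Scheme F G Unit} [Fintype T.UserRand]
    (h : T.UserPrivacy) (i : V) (k k' : G.edgeSet) (q : T.Query i) :
    ∑ u, (((if T.query k u i = q then 1 else 0) - (if T.query k' u i = q then 1 else 0) : ℤ) : ℝ) *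
      (T.userLaw u).toReal = 0 := by
  have h1 (k : G.edgeSet) :
      (T.law.map fun s => (T.Q k i s, T.A k i s, T.WStored i s, T.Rand s)).map Prod.fst =
        T.userLaw.map fun u => T.query k u i := by
    rw [← T.map_law_fst, PMF.map_comp, PMF.map_comp]
    rfl
  have h2 := congrArg (fun p => (PMF.map Prod.fst p q).toReal) (h i k k')
  simp only [h1, map_toReal_eq_sum] at h2
  rw [← sub_eq_zero, ← Finset.sum_sub_distrib] at h2
  rw [← h2]
  refine Finset.sum_congr rfl fun u _ => ?_
  push_cast
  split_ifs <;> ring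

variable [Fintype G.edgeSet]

lemma Scheme.law_toReal (T : Scheme F G Unit) (s : T.Sample) :
    (T.law s).toReal = (T.userLaw s.1).toReal * (Nat.card (Messages F G T.L) : ℝ)⁻¹ := by
  obtain ⟨u, w, r⟩ := s
  have hr : T.randLaw r = 1 := by
    have := T.randLaw.tsum_coe
    rwa [tsum_fintype, Fintype.sum_unique] at this
  rw [T.law_apply, hr]
  simp

/-- For a linear scheme, the desired message is determined by the answers to every query tuple of
positive probability. -/
lemma Scheme.Reliable.eq_zero {T : Scheme F G Unit} (h : T.Reliable) (hlin : T.IsLinear)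
    (k : G.edgeSet) (u : T.UserRand) (hu : T.userLaw u ≠ 0) (w : Messages F G T.L)
    (hw : ∀ i, Scheme.answerMap hlin i (T.query k u i) w = 0) : w k = 0 := by
  have := T.finite_userRand
  let _ : Fintype T.Sample := Fintype.ofFinite _
  have hpos (w : Messages F G T.L) : T.law (u, w, ()) ≠ 0 := by
    have hr : T.randLaw () = 1 := by
      have := T.randLaw.tsum_coe
      rwa [tsum_fintype, Fintype.sum_unique] at this
    rw [T.law_apply, hr]
    simp [hu]
  refine eq_of_condEntropy_eq_zero Fintype.one_lt_card (h k) (hpos w) (hpos 0) ?_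
  refine Prod.ext (funext fun i => ?_) rfl
  change Scheme.answerMap hlin i (T.query k u i) w = Scheme.answerMap hlin i (T.query k u i) 0
  rw [hw, map_zero]

/-- Independence of the queries and the database; it reduces the entropy in the symmetric retrieval
property to counting fibres of linear maps. -/
lemma Scheme.sum_law_ite (T : Scheme F G Unit) [Fintype T.UserRand] [Fintype T.Sample]
    (a : T.UserRand → Prop) (b : Messages F G T.L → Prop) :
    ∑ s : T.Sample, (if a s.1 ∧ b s.2.1 then (T.law s).toReal else 0) =
      (∑ u, if a u then (T.userLaw u).toReal else 0) *
        (Nat.card {w // b w} * (Nat.card (Messages F G T.L) : ℝ)⁻¹) := by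
  have h1 : ∑ s : T.Sample, (if a s.1 ∧ b s.2.1 then (T.law s).toReal else 0) =
      ∑ u : T.UserRand, ∑ w : Messages F G T.L, ∑ r : Unit,
        if a u ∧ b w then (T.userLaw u).toReal * (Nat.card (Messages F G T.L) : ℝ)⁻¹ else 0 := by
    simp only [T.law_toReal]
    rw [← Fintype.sum_prod_type', ← Fintype.sum_prod_type']
    exact Fintype.sum_equiv (Equiv.prodAssoc _ _ _).symm _ _ fun _ => rfl
  rw [h1, Finset.sum_mul]
  refine Finset.sum_congr rfl fun u _ => ?_
  by_cases hu : a u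
  · simp only [hu, true_and, if_true, Finset.univ_unique, Finset.sum_singleton]
    rw [← Finset.sum_filter, Finset.sum_const, ← Fintype.card_subtype,
      ← Nat.card_eq_fintype_card, nsmul_eq_mul]
    ring
  · simp [hu]

/-- For a linear scheme the symmetric retrieval property says that the mean rank of the desired
part of an answer is half the message length. -/
lemma Scheme.SymmetricRetrieval.sum_finrank_eq {T : Scheme F G Unit} [Fintype T.UserRand]
    (h : T.SymmetricRetrieval) (hlin : T.IsLinear) (k : G.edgeSet) (i : V)
    (hi : i ∈ (k : Sym2 V)) :
    ∑ u, ((2 * (Module.finrank F (LinearMap.range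
      (Scheme.edgeMap hlin i (T.query k u i) k)) : ℤ) - T.L : ℤ) : ℝ) *
        (T.userLaw u).toReal = 0 := by
  let _ : Fintype T.Sample := Fintype.ofFinite _
  let rk (u : T.UserRand) : ℕ :=
    Module.finrank F (LinearMap.range (Scheme.edgeMap hlin i (T.query k u i) k))
  let f : Messages F G T.L →ₗ[F] ({e : Stored G i // e.1 ≠ k} → Fin T.L → F) :=
    LinearMap.funLeft F (Fin T.L → F) (fun e : {e : Stored G i // e.1 ≠ k} => e.1.1)
  -- Once the other stored messages are fixed, only the message of `k` moves the answer.
  have hrange (q : T.Query i) :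
      LinearMap.range (Scheme.answerMap hlin i q ∘ₗ (LinearMap.ker f).subtype) =
        LinearMap.range (Scheme.edgeMap hlin i q k) := by
    apply le_antisymm
    · rintro _ ⟨⟨w, hw⟩, rfl⟩
      refine ⟨w k, ?_⟩
      change _ = Scheme.answerMap hlin i q w
      rw [Scheme.answerMap_eq_sum]
      refine Eq.symm ?_
      refine Finset.sum_eq_single k (fun e _ he => ?_) fun h => absurd (Finset.mem_univ k) h
      by_cases hie : i ∈ (e : Sym2 V)
      · have : w e = 0 := congrFun hw ⟨⟨e, hie⟩, he⟩
        rw [this, map_zero]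
      · rw [Scheme.edgeMap_eq_zero hlin i q e hie, LinearMap.zero_apply]
    · rintro _ ⟨v, rfl⟩
      refine ⟨⟨Pi.single k v, ?_⟩, rfl⟩
      ext1 e
      change (Pi.single k v : G.edgeSet → Fin T.L → F) e.1.1 = 0
      rw [Pi.single_eq_of_ne e.2]
  have hsrp := h k i hi
  rw [T.entropy_W, condEntropy_eq_sum] at hsrp
  -- Given the query and the other messages, the answer is uniform on a coset of the range of the
  -- edge map, so its surprise is the rank.
  have hterm (s : T.Sample) : (T.law s).toReal *
      (Real.log ((T.law.map (fun s => (T.Q k i s, T.WStoredOther i k s))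
        (T.Q k i s, T.WStoredOther i k s)).toReal /
        (T.law.map (fun t => (T.A k i t, (T.Q k i t, T.WStoredOther i k t)))
          (T.A k i s, (T.Q k i s, T.WStoredOther i k s))).toReal) /
        Real.log (Fintype.card F)) = (T.law s).toReal * rk s.1 := by
    by_cases hs : T.law s = 0
    · simp [hs]
    congr 1
    have h1 := map_toReal_pos T.law (fun t => (T.A k i t, (T.Q k i t, T.WStoredOther i k t))) hs
    have h2 : (T.law.map (fun s => (T.Q k i s, T.WStoredOther i k s))
        (T.Q k i s, T.WStoredOther i k s)).toReal =
          (∑ u, if T.query k u i = T.query k s.1 i then (T.userLaw u).toReal else 0) *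
            (Nat.card {w // f w = f s.2.1} * (Nat.card (Messages F G T.L) : ℝ)⁻¹) := by
      rw [map_toReal_eq_sum, ← T.sum_law_ite]
      refine Finset.sum_congr rfl fun t _ => ite_congr_iff ?_ _ _
      rw [Prod.mk.injEq]
      rfl
    have h3 : (T.law.map (fun t => (T.A k i t, (T.Q k i t, T.WStoredOther i k t)))
        (T.A k i s, (T.Q k i s, T.WStoredOther i k s))).toReal =
          (∑ u, if T.query k u i = T.query k s.1 i then (T.userLaw u).toReal else 0) *
            (Nat.card {w // f w = f s.2.1 ∧ Scheme.answerMap hlin i (T.query k s.1 i) w =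
              Scheme.answerMap hlin i (T.query k s.1 i) s.2.1} *
                (Nat.card (Messages F G T.L) : ℝ)⁻¹) := by
      rw [map_toReal_eq_sum, ← T.sum_law_ite]
      refine Finset.sum_congr rfl fun t _ => ite_congr_iff ?_ _ _
      rw [Prod.mk.injEq, Prod.mk.injEq]
      constructor
      · rintro ⟨hA, hQ, hW⟩
        refine ⟨hQ, hW, ?_⟩
        rw [Scheme.A, Scheme.A, hQ] at hA
        exact hA
      · rintro ⟨hQ, hW, hA⟩
        refine ⟨?_, hQ, hW⟩
        have hQ' : T.Q k i t = T.Q k i s := hQ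
        rw [Scheme.A, Scheme.A, hQ']
        exact hA
    have h4 : (T.law.map (fun s => (T.Q k i s, T.WStoredOther i k s))
        (T.Q k i s, T.WStoredOther i k s)).toReal = (Fintype.card F : ℝ) ^ rk s.1 *
          (T.law.map (fun t => (T.A k i t, (T.Q k i t, T.WStoredOther i k t)))
            (T.A k i s, (T.Q k i s, T.WStoredOther i k s))).toReal := by
      rw [h2, h3, card_fiber_eq f (Scheme.answerMap hlin i (T.query k s.1 i)) s.2.1, hrange]
      push_cast
      ring
    rw [h4, mul_div_cancel_right₀ _ h1.ne', Real.log_pow, mul_div_assoc,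
      div_self log_card_field_pos.ne', mul_one]
  rw [Finset.sum_congr rfl fun s _ => hterm s] at hsrp
  have hsum (g : T.UserRand → ℝ) :
      ∑ s : T.Sample, (T.law s).toReal * g s.1 = ∑ u, (T.userLaw u).toReal * g u := by
    have h1 : ∑ s : T.Sample, (T.law s).toReal * g s.1 =
        ∑ u : T.UserRand, ∑ w : Messages F G T.L, ∑ r : Unit,
          (T.userLaw u).toReal * (Nat.card (Messages F G T.L) : ℝ)⁻¹ * g u := by
      simp only [T.law_toReal]
      rw [← Fintype.sum_prod_type', ← Fintype.sum_prod_type']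
      exact Fintype.sum_equiv (Equiv.prodAssoc _ _ _).symm _ _ fun _ => rfl
    rw [h1]
    refine Finset.sum_congr rfl fun u _ => ?_
    have hne : (Nat.card (Messages F G T.L) : ℝ) ≠ 0 := Nat.cast_ne_zero.2 Nat.card_pos.ne'
    simp only [Finset.sum_const, Finset.card_univ, nsmul_eq_mul, ← Nat.card_eq_fintype_card,
      Nat.card_unique, Nat.cast_one, one_mul]
    field_simp
  rw [hsum fun u => (rk u : ℝ)] at hsrp
  have hone : ∑ u, (T.userLaw u).toReal = 1 := by
    rw [← ENNReal.toReal_sum fun u _ => T.userLaw.apply_ne_top u,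
      ← tsum_fintype (L := .unconditional _),
      T.userLaw.tsum_coe, ENNReal.toReal_one]
  have hfin : ∑ u, ((2 * (rk u : ℤ) - T.L : ℤ) : ℝ) * (T.userLaw u).toReal =
      2 * ∑ u, (T.userLaw u).toReal * rk u - T.L * ∑ u, (T.userLaw u).toReal := by
    rw [Finset.mul_sum, Finset.mul_sum, ← Finset.sum_sub_distrib]
    refine Finset.sum_congr rfl fun u _ => ?_
    push_cast
    ring
  refine hfin.trans ?_
  rw [hsrp, hone]
  ring

end PIR

/-! ### From a PIR scheme to an aligned code, by balanced copies. -/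

open scoped Classical

/-- A family of linear maps acting on blocks factors through the product of their ranges. -/
lemma exists_factorization {F I : Type} [Field F] [Fintype I] {a b n m : ℕ}
    (f : I → (Fin a → F) →ₗ[F] (Fin b → F)) (out : (I → Fin b → F) ≃ₗ[F] (Fin m → F))
    (hn : ∑ j, Module.finrank F (LinearMap.range (f j)) = n) :
    ∃ (C : (Fin n → F) →ₗ[F] (Fin m → F)) (X : (I → Fin a → F) →ₗ[F] (Fin n → F)),
      Function.Surjective X ∧ ∀ w, C (X w) = out fun j => f j (w j) := by
  -- Ranks may vary from copy to copy; only their total matters.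
  let φ : ((j : I) → LinearMap.range (f j)) ≃ₗ[F] (Fin n → F) :=
    LinearEquiv.ofFinrankEq _ _ (by rw [Module.finrank_pi_fintype, hn, Module.finrank_fin_fun])
  let X₀ : (I → Fin a → F) →ₗ[F] ((j : I) → LinearMap.range (f j)) :=
    LinearMap.pi fun j => (f j).rangeRestrict ∘ₗ LinearMap.proj j
  let C₀ : ((j : I) → LinearMap.range (f j)) →ₗ[F] (I → Fin b → F) :=
    LinearMap.pi fun j => (LinearMap.range (f j)).subtype ∘ₗ LinearMap.proj j
  refine ⟨out.toLinearMap ∘ₗ C₀ ∘ₗ φ.symm.toLinearMap, φ.toLinearMap ∘ₗ X₀, ?_, fun w => ?_⟩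
  · refine φ.surjective.comp fun r => ?_
    choose w hw using fun j => (f j).surjective_rangeRestrict (r j)
    exact ⟨w, funext hw⟩
  · change out (C₀ (φ.symm (φ (X₀ w)))) = _
    rw [φ.symm_apply_apply]
    rfl

lemma exists_blockEquiv {F : Type} [Field F] (I : Type) [Fintype I] (a : ℕ) :
    Nonempty ((I → Fin a → F) ≃ₗ[F] (Fin (Fintype.card I * a) → F)) :=
  ⟨LinearEquiv.ofFinrankEq _ _ (by simp [Module.finrank_pi_fintype])⟩

variable {V F : Type} {G : SimpleGraph V} [Field F] [Fintype V] [Fintype F]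

/-- On a balanced sample, the queries to a server for any two desired messages agree up to order. -/
lemma exists_perm_query {T : PIRScheme F G} [Fintype T.UserRand] (hT : T.UserPrivacy)
    {I : Type} [Fintype I] {τ : I → T.UserRand}
    (hτ : ∀ c : T.UserRand → ℤ, ∑ u, c u * (T.userLaw u).toReal = 0 → ∑ j, c (τ j) = 0)
    (i : V) (k k' : G.edgeSet) :
    ∃ π : I ≃ I, ∀ j, T.query k' (τ (π j)) i = T.query k (τ j) i := by
  have hcard (q : T.Query i) : Nat.card ((fun j => T.query k (τ j) i) ⁻¹' {q}) =
      Nat.card ((fun j => T.query k' (τ j) i) ⁻¹' {q}) := by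
    -- Equal probability of the query `q` is an integral linear relation; on the sample it becomes
    -- equality of counts.
    have h := hτ _ (hT.sum_query_eq i k k' q)
    rw [Finset.sum_sub_distrib, sub_eq_zero, Finset.sum_boole, Finset.sum_boole, Nat.cast_inj,
      ← Fintype.card_subtype, ← Fintype.card_subtype, ← Nat.card_eq_fintype_card,
      ← Nat.card_eq_fintype_card] at h
    exact h
  exact ⟨Equiv.ofPreimageEquiv fun q => (Finite.card_eq.1 (hcard q)).some,
    fun j => Equiv.ofPreimageEquiv_map (f := fun j => T.query k (τ j) i)
      (g := fun j => T.query k' (τ j) i) _ j⟩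

/-- Copies of a linear scheme with the symmetric retrieval property give an aligned code. -/
lemma exists_alignedCode_of_isPIR [Fintype G.edgeSet] [Nonempty G.edgeSet] (T : PIRScheme F G) (hT : T.IsPIR)
    (hlin : T.IsLinear) (hsrp : T.SymmetricRetrieval) (heven : Even T.L) {N : ℕ} (hN : 0 < N) :
    ∃ M y : ℕ, 0 < M ∧ M * T.L = 2 * (N * y) ∧
      Nonempty (AlignedCode F G (M * T.L) (N * y) fun i => M * T.len i) := by
  have := T.finite_userRand
  let _ : Fintype T.UserRand := Fintype.ofFinite _
  obtain ⟨I, _, _, τ, ⟨m, hm⟩, hsupp, hτ⟩ := exists_balanced_sample T.userLaw hN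
  obtain ⟨l, hl⟩ := heven
  have hy : Fintype.card I * T.L = 2 * (N * (m * l)) := by
    rw [hm, hl]
    ring
  let k₀ : G.edgeSet := Classical.arbitrary _
  choose π hπ using fun (k : G.edgeSet) (i : V) => exists_perm_query hT.1 hτ i k k₀
  have hrank (i : V) (e : G.edgeSet) (hi : i ∈ (e : Sym2 V)) :
      ∑ j, Module.finrank F (LinearMap.range (Scheme.edgeMap hlin i (T.query k₀ (τ j) i) e)) =
        N * (m * l) := by
    have h := hτ _ (hsrp.sum_finrank_eq hlin e i hi)
    rw [Finset.sum_sub_distrib, ← Finset.mul_sum, Finset.sum_const, Finset.card_univ,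
      nsmul_eq_mul] at h
    have h2 : ∑ j, Module.finrank F (LinearMap.range
        (Scheme.edgeMap hlin i (T.query e (τ j) i) e)) = N * (m * l) := by
      zify at hy ⊢
      linarith
    rw [← h2]
    -- Symmetric retrieval concerns queries that desire `e`; up to order these are the queries for
    -- `k₀`.
    refine (Fintype.sum_equiv (π e i) _ _ fun j => ?_).symm
    rw [hπ]
  obtain ⟨inp⟩ := exists_blockEquiv (F := F) I T.L
  let out (i : V) := (exists_blockEquiv (F := F) I (T.len i)).some
  have hfac (i : V) (e : G.edgeSet) :
      ∃ (C : (Fin (N * (m * l)) → F) →ₗ[F] (Fin (Fintype.card I * T.len i) → F))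
        (X : (I → Fin T.L → F) →ₗ[F] (Fin (N * (m * l)) → F)),
        (i ∉ (e : Sym2 V) → C = 0) ∧ (i ∈ (e : Sym2 V) → Function.Surjective X) ∧
        ∀ w, C (X w) = out i fun j => Scheme.edgeMap hlin i (T.query k₀ (τ j) i) e (w j) := by
    by_cases hi : i ∈ (e : Sym2 V)
    · obtain ⟨C, X, h1, h2⟩ := exists_factorization
        (fun j => Scheme.edgeMap hlin i (T.query k₀ (τ j) i) e) (out i) (hrank i e hi)
      exact ⟨C, X, fun h => absurd hi h, fun _ => h1, h2⟩
    · refine ⟨0, 0, fun _ => rfl, fun h => absurd h hi, fun w => ?_⟩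
      simp only [Scheme.edgeMap_eq_zero hlin i _ e hi, LinearMap.zero_apply]
      exact (map_zero (out i)).symm
  choose C X h1 h2 h3 using hfac
  -- Each server always answers the queries for `k₀` in the same order, so `C` is independent of
  -- `k`; the desired index enters only through a permutation of the message blocks.
  refine ⟨Fintype.card I, m * l, Fintype.card_pos, hy, exists_alignedCode (by omega) C h1
    (fun k i e => X i e ∘ₗ LinearMap.funLeft F (Fin T.L → F) (π k i).symm ∘ₗ
      inp.symm.toLinearMap) (fun k i e hi => ?_) fun k W hW => ?_⟩
  · exact (h2 i e hi).comp ((LinearMap.funLeft_surjective_of_injective F (Fin T.L → F) _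
      (π k i).symm.injective).comp inp.symm.surjective)
  · rw [← map_eq_zero_iff _ inp.symm.injective]
    ext1 j
    refine hT.2.eq_zero hlin k (τ j) (hsupp j) (fun e => inp.symm (W e) j) fun i => ?_
    have h4 : ∑ e, (fun j' => Scheme.edgeMap hlin i (T.query k₀ (τ j') i) e
        (inp.symm (W e) ((π k i).symm j'))) = 0 := by
      rw [← map_eq_zero_iff _ (out i).injective, map_sum, ← hW i]
      refine Finset.sum_congr rfl fun e _ => ?_
      exact (h3 i e _).symm
    -- In this slot server `i` answers its query of copy `j`, applied to block `j` of every message.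
    -- Over all `i` these slots form a full answer tuple of the original scheme.
    have h5 := congrFun h4 (π k i j)
    rw [Finset.sum_apply] at h5
    rw [Scheme.answerMap_eq_sum]
    refine Eq.trans (Finset.sum_congr rfl fun e _ => ?_) h5
    rw [(π k i).symm_apply_apply, hπ]

end GraphPIR

/-! ### Comparison of parameters. -/

theorem theorem5 {V F : Type} [Fintype V] [Field F] [Fintype F] (G : SimpleGraph V)
    (hG : G.Connected) (N K : ℕ) (hN : N = Fintype.card V) (hK : K = Nat.card G.edgeSet)
    (hK2 : 2 ≤ K)
    (T : GraphPIR.PIRScheme F G) (hT : T.IsPIR) (hlin : T.IsLinear)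
    (hSRP : T.SymmetricRetrieval) (heven : Even T.L)
    (L' D' l x y : ℕ) (hL' : L' = T.L) (hD' : D' = T.downloads)
    (hl : l = Nat.lcm (L' / 2) (N - 1)) (hx : x = l / (L' / 2)) (hy : y = l / (N - 1)) :
    (∃ (R : Type) (_ : Finite R) (S : GraphPIR.Scheme F G R), S.IsSPIR ∧
      (∀ k, S.rate k = ((L' : ℝ) * x) / (D' * x + N * y)) ∧
      S.totalRandRatio = ((K : ℝ) - 1) / 2 + (N * y : ℝ) / (L' * x)) ∧
    (((((L' : ℝ) * x) / (D' * x + N * y) : ℝ)) : EReal) ≤ GraphPIR.capacityFR F G ∧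
    GraphPIR.optTotalRandRatio F G ≤
      (((((K : ℝ) - 1) / 2 + (N * y : ℝ) / (L' * x) : ℝ)) : EReal) := by
  suffices h : ∃ (R : Type) (_ : Finite R) (S : GraphPIR.Scheme F G R), S.IsSPIR ∧
      (∀ k, S.rate k = ((L' : ℝ) * x) / (D' * x + N * y)) ∧
      S.totalRandRatio = ((K : ℝ) - 1) / 2 + (N * y : ℝ) / (L' * x) by
    refine ⟨h, ?_⟩
    obtain ⟨R, hR, S, hS, hrate, hrand⟩ := h
    exact ⟨le_sSup ⟨R, hR, S, hS, fun k => by rw [hrate k]⟩,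
      sInf_le ⟨R, hR, S, hS, by rw [hrand]⟩⟩
  let _ : Fintype G.edgeSet := Fintype.ofFinite _
  have : Nonempty V := hG.nonempty
  have : Nonempty G.edgeSet := (Nat.card_pos_iff.1 (by omega)).1
  obtain ⟨⟨e, he⟩⟩ := this
  have hN2 : 1 < Fintype.card V := by
    induction e using Sym2.ind with
    | _ a b => exact Fintype.one_lt_card_iff.2 ⟨a, b, G.ne_of_adj he⟩
  have : Nonempty G.edgeSet := ⟨⟨e, he⟩⟩
  have hT0 := T.L_pos
  obtain ⟨M, z, hM, hMz, ⟨D⟩⟩ := GraphPIR.exists_alignedCode_of_isPIR T hT hlin hSRP heven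
    (N := Fintype.card V - 1) (by omega)
  obtain ⟨B⟩ := GraphPIR.exists_splitting (V := V) (F := F) z
  have hpos : 0 < M * T.L := Nat.mul_pos hM hT0
  refine ⟨_, inferInstance, D.scheme B hpos, D.scheme_isSPIR B hpos, fun k => ?_, ?_⟩
  all_goals
    have hhalf : L' = 2 * (L' / 2) := by rw [hL']; exact (Nat.two_mul_div_two_of_even heven).symm
    have hh : 0 < L' / 2 := by omega
    have hn : 0 < N - 1 := by omega
    have hlpos : 0 < l := hl ▸ Nat.lcm_pos hh hn
    have hlx : l = L' / 2 * x := by rw [hx, hl, Nat.mul_div_cancel' (Nat.dvd_lcm_left _ _)]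
    have hly : l = (N - 1) * y := by rw [hy, hl, Nat.mul_div_cancel' (Nat.dvd_lcm_right _ _)]
    have hxpos : 0 < x := Nat.pos_of_ne_zero fun h => by simp [h] at hlx; omega
    rw [← hN, ← hL'] at hMz
    have e1 : (L' : ℝ) * x = 2 * ((N - 1 : ℕ) * y) := by
      have : L' * x = 2 * ((N - 1) * y) := by rw [← hly, hlx]; nlinarith
      exact_mod_cast this
    have e2 : (M : ℝ) * L' = 2 * ((N - 1 : ℕ) * z) := by exact_mod_cast hMz
    have hL0 : (0 : ℝ) < L' := by exact_mod_cast (by omega : 0 < L')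
    have hx0 : (0 : ℝ) < x := by exact_mod_cast hxpos
    have hM0 : (0 : ℝ) < M := by exact_mod_cast hM
    have hn0 : (0 : ℝ) < (N - 1 : ℕ) := by exact_mod_cast hn
    -- The number of copies need not be `x`. Both pairs `(L' * x, y)` and `(M * L', z)` have first
    -- entry `2 * (N - 1)` times the second, and only ratios matter.
    have e3 : (M : ℝ) * y = z * x := by
      have : ((N - 1 : ℕ) : ℝ) * (M * y) = (N - 1 : ℕ) * (z * x) := by
        linear_combination (x : ℝ) / 2 * e2 - (M : ℝ) / 2 * e1
      exact mul_left_cancel₀ hn0.ne' this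
  · rw [D.scheme_rate, ← hN]
    have hd : ∑ i, ((M * T.len i : ℕ) : ℝ) = M * D' := by
      rw [hD', GraphPIR.Scheme.downloads]
      push_cast
      rw [Finset.mul_sum]
    rw [hd, ← hL', ← mul_div_mul_left ((M * L' : ℕ) : ℝ) _ hx0.ne',
      ← mul_div_mul_left ((L' : ℝ) * x) _ hM0.ne']
    congr 1
    · push_cast
      ring
    · linear_combination (-(N : ℝ)) * e3
  -- Both expressions equal `K / 2 + 1 / (2 * (N - 1))`.
  · rw [D.scheme_totalRandRatio, ← hN, ← Nat.card_eq_fintype_card, ← hK, ← hL']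
    have e4 : ((N - 1 : ℕ) : ℝ) = N - 1 := by
      rw [Nat.cast_sub (by omega), Nat.cast_one]
    rw [e4] at e1 e2
    push_cast
    rw [e4, div_add_div _ _ two_ne_zero (by positivity),
      div_eq_div_iff (by positivity) (by positivity)]
    rw [e1, e2]
    ring
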